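/- Let $\Sigma$ be a surface, that is, a connected (Hausdorff, second countable) $C^\infty$ manifold of dimension $2$, and let $\nabla$ be an RSTS connection on $\Sigma$: a $C^\infty$ torsion-free connection in the tangent bundle $T\Sigma$ whose Ricci tensor $\rho$ is skew-symmetric at every point. Here $\rho(u,w)$ is the trace of $v\mapsto R(u,v)w$, with the curvature sign convention $R(u,v)z=\nabla_v\nabla_u z-\nabla_u\nabla_v z+\nabla_{[u,v]}z$. Suppose that $\rho\neq0$ at every point of $\Sigma$. Let $\mathcal{L}$ be the Killing operator of $\nabla$, sending each $C^\infty$ $1$-form $\xi$ on $\Sigma$ to the symmetric $2$-tensor $\mathcal{L}\xi$ with $2[\mathcal{L}\xi](u,v)=[\nabla_u\xi](v)+[\nabla_v\xi](u)$, and let $\mathrm{Ker}\,\mathcal{L}$ be the real vector space of all $C^\infty$ $1$-forms $\xi$ on $\Sigma$ with $\mathcal{L}\xi=0$. Suppose that $\dim\mathrm{Ker}\,\mathcal{L}=1$. Then there exists a dense open set $U\subset\Sigma$ such that every point of $U$ has an open neighborhood $W$ carrying $C^\infty$ vector fields $v,w$ that trivialize the tangent bundle of $W$, and $C^\infty$ functions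 $\psi,\chi:W\to\mathbb{R}$, for which, on $W$, $$[v,w]=6v+2\psi w,\quad d_v\psi=4\psi^2,\quad d_w\psi=-4\psi,\quad d_v\chi=4,\quad \psi\neq0\ \text{everywhere},$$ and $$\nabla_v v=5\psi v,\quad \nabla_w v=\psi w,\quad \nabla_v w=6v+3\psi w,\quad \nabla_w w=15\chi v-4w.$$ -/

import Mathlib

open Bundle FiberBundle VectorField NormedSpace
open scoped Manifold ContDiff Topology

noncomputable section

namespace SurfaceConnection

section Types

variable (M : Type*) [TopologicalSpace M] [ChartedSpace (EuclideanSpace ℝ (Fin 2)) M]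
  [IsManifold (𝓡 2) ∞ M]

/-- Connections in the tangent bundle of `M` (their smoothness is imposed separately).
The value of `∇_X Y` at `x` is `nabla Y x (X x)`. -/
abbrev Connection : Type _ :=
  CovariantDerivative (𝓡 2) (EuclideanSpace ℝ (Fin 2)) (TangentSpace (𝓡 2) : M → Type _)

/-- Smooth 1-forms on `M`. -/
abbrev OneForm : Type _ :=
  ContMDiffSection (𝓡 2) (EuclideanSpace ℝ (Fin 2) →L[ℝ] ℝ) ∞
    (fun x : M => TangentSpace (𝓡 2) x →L[ℝ] Trivial M ℝ x)

end Types

variable {M : Type*} [TopologicalSpace M] [ChartedSpace (EuclideanSpace ℝ (Fin 2)) M]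

/-- A basis of the tangent plane at `x`, used only to write down a trace. -/
def tangentBasis (x : M) : Module.Basis (Fin 2) ℝ (TangentSpace (𝓡 2) x) :=
  (EuclideanSpace.basisFun (Fin 2) ℝ).toBasis

variable [IsManifold (𝓡 2) ∞ M]

/-- The vector field `R(X, Y) Z = ∇_Y ∇_X Z - ∇_X ∇_Y Z + ∇_{[X, Y]} Z`. -/
def curvatureField (nabla : Connection M) (X Y Z : Π x : M, TangentSpace (𝓡 2) x) :
    Π x : M, TangentSpace (𝓡 2) x := fun x =>
  nabla (fun y => nabla Z y (X y)) x (Y x) - nabla (fun y => nabla Z y (Y y)) x (X x)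
    + nabla Z x (mlieBracket (𝓡 2) X Y x)

/-- The curvature tensor `R(u, v) z` at `x`. The tangent vectors are extended to vector fields
that are smooth near `x`; by tensoriality, the choice of the extensions is immaterial. -/
def curvature (nabla : Connection M) (x : M) (u v z : TangentSpace (𝓡 2) x) :
    TangentSpace (𝓡 2) x :=
  curvatureField nabla (extend (EuclideanSpace ℝ (Fin 2)) u) (extend (EuclideanSpace ℝ (Fin 2)) v)
    (extend (EuclideanSpace ℝ (Fin 2)) z) x

/-- The Ricci tensor: `ρ(u, w)` is the trace of `v ↦ R(u, v) w`. -/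
def ricci (nabla : Connection M) (x : M) (u w : TangentSpace (𝓡 2) x) : ℝ :=
  ∑ i, (tangentBasis x).coord i (curvature nabla x u (tangentBasis x i) w)

theorem ricci_eq_trace (nabla : Connection M) (x : M) (u w : TangentSpace (𝓡 2) x)
    (T : TangentSpace (𝓡 2) x →ₗ[ℝ] TangentSpace (𝓡 2) x)
    (hT : ∀ v, T v = curvature nabla x u v w) :
    ricci nabla x u w = LinearMap.trace ℝ _ T := by
  rw [LinearMap.trace_eq_matrix_trace ℝ (tangentBasis x), Matrix.trace]
  simp [ricci, LinearMap.toMatrix_apply, hT]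

/-- `(∇_u ξ)(v) = d_u [ξ(V)] - ξ(∇_u V)` at `x`, where `V` is a vector field with value `v` at `x`
(the choice of `V` is immaterial, see `covDerivForm_apply`). -/
def covDerivForm (nabla : Connection M) (ξ : OneForm M) (x : M) (u v : TangentSpace (𝓡 2) x) : ℝ :=
  mvfderiv (𝓡 2) (F := ℝ) (fun y => ξ y (extend (EuclideanSpace ℝ (Fin 2)) v y)) x u
    - ξ x (nabla (extend (EuclideanSpace ℝ (Fin 2)) v) x u)

theorem mdifferentiableAt_pairing (ξ : OneForm M) {x : M} {V : Π x : M, TangentSpace (𝓡 2) x}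
    (hV : MDifferentiableAt (𝓡 2) (𝓡 2).tangent (fun y => (⟨y, V y⟩ : TangentBundle (𝓡 2) M)) x) :
    MDifferentiableAt (𝓡 2) 𝓘(ℝ, ℝ) (fun y => (ξ y (V y) : ℝ)) x := by
  have h1 := (ξ.contMDiff x).mdifferentiableAt (by simp)
  have h2 := MDifferentiableAt.clm_bundle_apply (F₁ := EuclideanSpace ℝ (Fin 2)) (F₂ := ℝ)
    (E₁ := (TangentSpace (𝓡 2) : M → Type _)) (E₂ := Trivial M ℝ) (b := id)
    (ϕ := fun y => ξ y) (v := V) h1 hV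
  have h3 := (mdifferentiableAt_section (𝓡 2) (fun y => ξ y (V y))).1 h2
  exact h3

theorem covDerivForm_apply (nabla : Connection M) (ξ : OneForm M) {x : M}
    (u : TangentSpace (𝓡 2) x) {V : Π x : M, TangentSpace (𝓡 2) x} (hV : MDifferentiableAt (𝓡 2) (𝓡 2).tangent (fun y => (⟨y, V y⟩ : TangentBundle (𝓡 2) M)) x) :
    covDerivForm nabla ξ x u (V x)
      = mvfderiv (𝓡 2) (F := ℝ) (fun y => ξ y (V y)) x u - ξ x (nabla V x u) := by
  have key : TensorialAt (𝓡 2) (EuclideanSpace ℝ (Fin 2))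
      (fun V : Π x : M, TangentSpace (𝓡 2) x =>
        (mvfderiv (𝓡 2) (F := ℝ) (fun y => ξ y (V y)) x u - ξ x (nabla V x u) : ℝ)) x :=
    { smul := by
        intro f σ hf hσ
        have h1 := mvfderiv_mul (I := 𝓡 2) hf (mdifferentiableAt_pairing ξ hσ)
        have h2 := nabla.isCovariantDerivativeOnUniv.leibniz hσ hf
        have h3 : (fun y => (ξ y ((f • σ) y) : ℝ)) = f * fun y => (ξ y (σ y) : ℝ) := by
          funext y; simp
        rw [h2]
        erw [h3]
        rw [h1]
        simp
        ring
      add := by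
        intro σ σ' hσ hσ'
        have h1 := mvfderiv_add (I := 𝓡 2) (mdifferentiableAt_pairing ξ hσ)
          (mdifferentiableAt_pairing ξ hσ')
        have h2 := nabla.isCovariantDerivativeOnUniv.add hσ hσ'
        have h3 : (fun y => (ξ y ((σ + σ') y) : ℝ))
            = (fun y => (ξ y (σ y) : ℝ)) + fun y => (ξ y (σ' y) : ℝ) := by
          funext y; simp
        rw [h2]
        erw [h3]
        rw [h1]
        simp
        ring }
  exact key.pointwise (mdifferentiableAt_extend ..) hV (by simp)

theorem covDerivForm_add (nabla : Connection M) (ξ η : OneForm M) (x : M)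
    (u v : TangentSpace (𝓡 2) x) :
    covDerivForm nabla (ξ + η) x u v = covDerivForm nabla ξ x u v + covDerivForm nabla η x u v := by
  have hV : MDifferentiableAt (𝓡 2) (𝓡 2).tangent
      (fun y => (⟨y, extend (EuclideanSpace ℝ (Fin 2)) v y⟩ : TangentBundle (𝓡 2) M)) x := mdifferentiableAt_extend ..
  have h := mvfderiv_add (I := 𝓡 2) (mdifferentiableAt_pairing ξ hV)
    (mdifferentiableAt_pairing η hV)
  have h3 : (fun y => ((ξ + η) y (extend (EuclideanSpace ℝ (Fin 2)) v y) : ℝ))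
      = (fun y => (ξ y (extend (EuclideanSpace ℝ (Fin 2)) v y) : ℝ))
        + fun y => (η y (extend (EuclideanSpace ℝ (Fin 2)) v y) : ℝ) := by
    funext y; simp
  unfold covDerivForm
  erw [h3]
  rw [h]
  simp
  ring

theorem covDerivForm_smul (nabla : Connection M) (c : ℝ) (ξ : OneForm M) (x : M)
    (u v : TangentSpace (𝓡 2) x) :
    covDerivForm nabla (c • ξ) x u v = c * covDerivForm nabla ξ x u v := by
  have hV : MDifferentiableAt (𝓡 2) (𝓡 2).tangent
      (fun y => (⟨y, extend (EuclideanSpace ℝ (Fin 2)) v y⟩ : TangentBundle (𝓡 2) M)) x := mdifferentiableAt_extend ..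
  have h := mvfderiv_mul (I := 𝓡 2) (f := fun _ : M => c) mdifferentiableAt_const
    (mdifferentiableAt_pairing ξ hV)
  have h3 : (fun y => ((c • ξ) y (extend (EuclideanSpace ℝ (Fin 2)) v y) : ℝ))
      = (fun _ => c) * fun y => (ξ y (extend (EuclideanSpace ℝ (Fin 2)) v y) : ℝ) := by
    funext y; simp
  unfold covDerivForm
  erw [h3]
  rw [h, mvfderiv_const]
  simp
  ring

/-- The Killing operator: `2 (L ξ)(u, v) = (∇_u ξ)(v) + (∇_v ξ)(u)`. -/
def killingOperator (nabla : Connection M) (ξ : OneForm M) (x : M)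
    (u v : TangentSpace (𝓡 2) x) : ℝ :=
  (covDerivForm nabla ξ x u v + covDerivForm nabla ξ x v u) / 2

/-- The kernel of the Killing operator on the space of all smooth 1-forms on `M`. -/
def killingKernel (nabla : Connection M) : Submodule ℝ (OneForm M) where
  carrier := {ξ | ∀ x u v, killingOperator nabla ξ x u v = 0}
  zero_mem' := by
    intro x u v
    have h (u v) : covDerivForm nabla (0 : OneForm M) x u v = 0 := by
      have h0 := covDerivForm_add nabla 0 0 x u v
      rw [add_zero] at h0
      linarith
    simp [killingOperator, h]
  add_mem' := by
    intro ξ η hξ hη x u v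
    have h1 := hξ x u v
    have h2 := hη x u v
    simp only [killingOperator, covDerivForm_add] at h1 h2 ⊢
    linarith
  smul_mem' := by
    intro c ξ hξ x u v
    have h1 := hξ x u v
    simp only [killingOperator, covDerivForm_smul] at h1 ⊢
    linear_combination c * h1

/-- An RSTS connection: a smooth torsion-free connection on a surface, the Ricci tensor of which
is skew-symmetric at every point. -/
structure IsRSTS (nabla : Connection M) : Prop where
  smooth : CovariantDerivative.ContMDiffCovariantDerivative nabla ∞
  torsion_eq_zero : ∀ x, nabla.torsion x = 0
  ricci_skew : ∀ x u w, ricci nabla x u w = -ricci nabla x w u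

/-- On the open set `W` the fields `v, w` and the functions `ψ, χ` are smooth, `v, w` trivialize
the tangent bundle, and `[v, w] = 6 v + 2 ψ w`, `d_v ψ = 4 ψ ^ 2`, `d_w ψ = -4 ψ`, `d_v χ = 4`,
`ψ ≠ 0`. Values outside `W` play no role. -/
structure IsQuadrupleOn (W : Set M) (v w : Π x : M, TangentSpace (𝓡 2) x) (ψ χ : M → ℝ) :
    Prop where
  smooth_v : ContMDiffOn (𝓡 2) (𝓡 2).tangent ∞ (fun x => (⟨x, v x⟩ : TangentBundle (𝓡 2) M)) W
  smooth_w : ContMDiffOn (𝓡 2) (𝓡 2).tangent ∞ (fun x => (⟨x, w x⟩ : TangentBundle (𝓡 2) M)) W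
  smooth_psi : ContMDiffOn (𝓡 2) 𝓘(ℝ, ℝ) ∞ ψ W
  smooth_chi : ContMDiffOn (𝓡 2) 𝓘(ℝ, ℝ) ∞ χ W
  linearIndependent : ∀ x ∈ W, LinearIndependent ℝ ![v x, w x]
  span_eq_top : ∀ x ∈ W, Submodule.span ℝ {v x, w x} = ⊤
  bracket : ∀ x ∈ W, mlieBracket (𝓡 2) v w x = (6 : ℝ) • v x + (2 * ψ x) • w x
  deriv_psi_v : ∀ x ∈ W, mvfderiv (𝓡 2) ψ x (v x) = 4 * ψ x ^ 2
  deriv_psi_w : ∀ x ∈ W, mvfderiv (𝓡 2) ψ x (w x) = -4 * ψ x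
  deriv_chi_v : ∀ x ∈ W, mvfderiv (𝓡 2) χ x (v x) = 4
  psi_ne_zero : ∀ x ∈ W, ψ x ≠ 0

/-- On the set `W` the connection is given by `∇_v v = 5 ψ v`, `∇_w v = ψ w`,
`∇_v w = 6 v + 3 ψ w`, `∇_w w = 15 χ v - 4 w`. -/
structure IsGivenByOn (nabla : Connection M) (W : Set M) (v w : Π x : M, TangentSpace (𝓡 2) x)
    (ψ χ : M → ℝ) : Prop where
  nabla_v_v : ∀ x ∈ W, nabla v x (v x) = (5 * ψ x) • v x
  nabla_w_v : ∀ x ∈ W, nabla v x (w x) = ψ x • w x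
  nabla_v_w : ∀ x ∈ W, nabla w x (v x) = (6 : ℝ) • v x + (3 * ψ x) • w x
  nabla_w_w : ∀ x ∈ W, nabla w x (w x) = (15 * χ x) • v x - (4 : ℝ) • w x

end SurfaceConnection

end

/-! In dimension two a skew Ricci tensor determines the whole curvature: `R(u, v) z = ρ(u, v) z`
(`exists_area_of_trilinear`). For a Killing form `ξ` the tensor `∇ξ` is skew, and the Ricci identity
then gives the prolongation `(∇_Z ∇ξ)(X, Y) = -ρ(X, Y) ξ(Z)` (`secondCovDeriv_eq`). So `(ξ, ∇ξ)`
solves a closed linear first-order system.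

The kernel contains some `ξ ≠ 0`. By Grönwall and connectedness, `(ξ, ∇ξ)` vanishes at no point. If
`ξ` vanished on an open set, so would `∇ξ`; if `∇ξ` did, so would `ρ ⊗ ξ`, hence `ξ`, as `ρ ≠ 0`.
Thus the set `U` where both `ξ` and `∇ξ` are nonzero is open and dense.

Near a point of `U` the invariants are the function `ψ` with `∇ξ = (ψ/4) ρ` and the field `v` with
`ρ(v, ·) = 4ξ`, completed to a frame by any `e` with `ξ(e) = ψ` (`exists_isKillingFrame`). The
equations for `ξ` and `∇ξ`, with vanishing torsion, express the connection and `dψ` through four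
functions `a, p, m, q` (`exists_structureEqs`). The commutator `[v, e]` acting on `ψ`, combined with
the curvature, forces `a = 5ψ` (`a_eq`). The remaining freedom `e ↦ e + g v` normalizes `p = 0`; the
curvature then gives `m = 6` and `d_v q = 60`, so `χ = q/15` (`exists_quadruple`). -/

set_option linter.unusedSectionVars false

noncomputable section

namespace SurfaceConnection

/-! ### Derivations along vector fields and Lie brackets -/

section Calculus

variable {M : Type*} [TopologicalSpace M] [ChartedSpace (EuclideanSpace ℝ (Fin 2)) M]
  [IsManifold (𝓡 2) ∞ M]

/-- Smoothness of a vector field on a set. -/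
abbrev SmoothField (W : Set M) (X : Π x : M, TangentSpace (𝓡 2) x) : Prop :=
  ContMDiffOn (𝓡 2) (𝓡 2).tangent ∞ (fun x => (⟨x, X x⟩ : TangentBundle (𝓡 2) M)) W

/-- Smoothness of a real function on a set. -/
abbrev SmoothFun (W : Set M) (g : M → ℝ) : Prop :=
  ContMDiffOn (𝓡 2) 𝓘(ℝ, ℝ) ∞ g W

/-- The derivative of a function in the direction of a vector field. -/
def dirDeriv (X : Π x : M, TangentSpace (𝓡 2) x) (g : M → ℝ) : M → ℝ :=
  fun x => mvfderiv (𝓡 2) g x (X x)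

variable {W : Set M} {X Y Z : Π x : M, TangentSpace (𝓡 2) x} {f g : M → ℝ} {x : M}

theorem SmoothFun.mdiff (hg : SmoothFun W g) (hW : IsOpen W) (hx : x ∈ W) :
    MDifferentiableAt (𝓡 2) 𝓘(ℝ, ℝ) g x :=
  (hg.contMDiffAt (hW.mem_nhds hx)).mdifferentiableAt (by simp)

theorem SmoothField.mdiff (hX : SmoothField W X) (hW : IsOpen W) (hx : x ∈ W) :
    MDifferentiableAt (𝓡 2) (𝓡 2).tangent (fun y => (⟨y, X y⟩ : TangentBundle (𝓡 2) M)) x :=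
  (hX.contMDiffAt (hW.mem_nhds hx)).mdifferentiableAt (by simp)

theorem SmoothField.smul (hg : SmoothFun W g) (hX : SmoothField W X) : SmoothField W (g • X) :=
  ContMDiffOn.smul_section (V := (TangentSpace (𝓡 2) : M → Type _)) hg hX

theorem SmoothField.add (hX : SmoothField W X) (hY : SmoothField W Y) : SmoothField W (X + Y) :=
  ContMDiffOn.add_section (V := (TangentSpace (𝓡 2) : M → Type _)) hX hY

theorem SmoothField.sub (hX : SmoothField W X) (hY : SmoothField W Y) : SmoothField W (X - Y) :=
  ContMDiffOn.sub_section (V := (TangentSpace (𝓡 2) : M → Type _)) hX hY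

theorem SmoothField.neg (hX : SmoothField W X) : SmoothField W (-X) :=
  ContMDiffOn.neg_section (V := (TangentSpace (𝓡 2) : M → Type _)) hX

theorem SmoothField.mlieBracket (hW : IsOpen W) (hX : SmoothField W X) (hY : SmoothField W Y) :
    SmoothField W (mlieBracket (𝓡 2) X Y) := by
  have : IsManifold (𝓡 2) ((⊤ : ℕ∞) + 1) M := by simpa using (inferInstance : IsManifold (𝓡 2) ∞ M)
  have : IsManifold (𝓡 2) (minSmoothness ℝ 2) M := by
    simp only [minSmoothness_of_isRCLikeNormedField]; infer_instance
  intro x hx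
  have h := ContMDiffAt.mlieBracket_vectorField (m := ⊤) (n := ⊤)
    (hX.contMDiffAt (hW.mem_nhds hx)) (hY.contMDiffAt (hW.mem_nhds hx)) (by simp)
  exact h.contMDiffWithinAt

theorem SmoothFun.dirDeriv (hW : IsOpen W) (hX : SmoothField W X) (hg : SmoothFun W g) :
    SmoothFun W (dirDeriv X g) := by
  have h1 := hg.contMDiffOn_tangentMapWithin (m := ∞) (by simp) hW.uniqueMDiffOn
  have h2 := (contMDiff_snd_tangentBundle_modelSpace ℝ 𝓘(ℝ, ℝ) (n := ∞)).comp_contMDiffOn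
    (h1.comp hX (fun y hy => hy))
  refine h2.congr fun y hy => ?_
  simp only [SurfaceConnection.dirDeriv, mvfderiv, Function.comp, tangentMapWithin]
  rw [mfderivWithin_of_isOpen hW hy]
  rfl

theorem dirDeriv_congr (hW : IsOpen W) (hx : x ∈ W) (h : Set.EqOn f g W) :
    dirDeriv X f x = dirDeriv X g x := by
  have h1 : f =ᶠ[𝓝 x] g := Filter.eventuallyEq_of_mem (hW.mem_nhds hx) h
  have h2 := h1.mfderiv_eq (I := 𝓡 2) (I' := 𝓘(ℝ, ℝ))
  simp only [dirDeriv, mvfderiv]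
  erw [h2]
  rfl

theorem dirDeriv_add (hf : MDifferentiableAt (𝓡 2) 𝓘(ℝ, ℝ) f x)
    (hg : MDifferentiableAt (𝓡 2) 𝓘(ℝ, ℝ) g x) :
    dirDeriv X (f + g) x = dirDeriv X f x + dirDeriv X g x := by
  simp only [dirDeriv]
  rw [mvfderiv_add hf hg]
  rfl

theorem dirDeriv_sub (hf : MDifferentiableAt (𝓡 2) 𝓘(ℝ, ℝ) f x)
    (hg : MDifferentiableAt (𝓡 2) 𝓘(ℝ, ℝ) g x) :
    dirDeriv X (f - g) x = dirDeriv X f x - dirDeriv X g x := by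
  simp only [dirDeriv]
  rw [mvfderiv_sub hf hg]
  rfl

theorem dirDeriv_mul (hf : MDifferentiableAt (𝓡 2) 𝓘(ℝ, ℝ) f x)
    (hg : MDifferentiableAt (𝓡 2) 𝓘(ℝ, ℝ) g x) :
    dirDeriv X (f * g) x = f x * dirDeriv X g x + g x * dirDeriv X f x := by
  simp only [dirDeriv]
  rw [mvfderiv_mul hf hg]
  rfl

theorem dirDeriv_const (c : ℝ) : dirDeriv X (fun _ => c) x = 0 := by
  simp only [dirDeriv]
  rw [mvfderiv_const]
  rfl

theorem dirDeriv_add_left : dirDeriv (X + Y) f x = dirDeriv X f x + dirDeriv Y f x := by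
  simp [dirDeriv]

theorem dirDeriv_smul_left : dirDeriv (g • X) f x = g x * dirDeriv X f x := by
  simp [dirDeriv]

theorem mlieBracket_smul_right' (hg : MDifferentiableAt (𝓡 2) 𝓘(ℝ, ℝ) g x)
    (hY : MDifferentiableAt (𝓡 2) (𝓡 2).tangent (fun y => (⟨y, Y y⟩ : TangentBundle (𝓡 2) M)) x) :
    mlieBracket (𝓡 2) X (g • Y) x = dirDeriv X g x • Y x + g x • mlieBracket (𝓡 2) X Y x :=
  mlieBracket_smul_right hg hY

theorem mlieBracket_congr (hW : IsOpen W) (hx : x ∈ W) {X' Y' : Π x : M, TangentSpace (𝓡 2) x}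
    (hX : Set.EqOn X X' W) (hY : Set.EqOn Y Y' W) :
    mlieBracket (𝓡 2) X Y x = mlieBracket (𝓡 2) X' Y' x :=
  Filter.EventuallyEq.mlieBracket_vectorField_eq
    (Filter.eventuallyEq_of_mem (hW.mem_nhds hx) hX)
    (Filter.eventuallyEq_of_mem (hW.mem_nhds hx) hY)

theorem smoothField_extend {x : M} (u : TangentSpace (𝓡 2) x) :
    SmoothField (chartAt (EuclideanSpace ℝ (Fin 2)) x).source
      (extend (EuclideanSpace ℝ (Fin 2)) u) := by
  have h := ((trivializationAt (EuclideanSpace ℝ (Fin 2)) (TangentSpace (𝓡 2) : M → Type _)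
    x).contMDiffOn_section_baseSet_iff (IB := 𝓡 2) (n := ∞)
    (s := extend (EuclideanSpace ℝ (Fin 2)) u)).2 ?_
  · exact h
  · refine (contMDiffOn_const (c := (trivializationAt (EuclideanSpace ℝ (Fin 2))
      (TangentSpace (𝓡 2) : M → Type _) x ⟨x, u⟩).2)).congr fun y hy => ?_
    simp only [extend]
    rw [Trivialization.apply_mk_symm _ hy]

/-- The Jacobi identity for `X, Y, gZ`, expanded by the Leibniz rule, minus `g` times the one for
`X, Y, Z`, leaves only the terms in which `g` absorbs both derivatives. This yields the commutator
formula on functions, still multiplied by `Z`. -/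
theorem dirDeriv_mlieBracket_smul (hx : x ∈ W) (hW : IsOpen W) (hX : SmoothField W X)
    (hY : SmoothField W Y) (hg : SmoothFun W g) (hZ : SmoothField W Z) :
    dirDeriv (mlieBracket (𝓡 2) X Y) g x • Z x
      = (dirDeriv X (dirDeriv Y g) x - dirDeriv Y (dirDeriv X g) x) • Z x := by
  have two_le : minSmoothness ℝ 2 ≤ (∞ : WithTop ℕ∞) := by
    simp only [minSmoothness_of_isRCLikeNormedField]; exact WithTop.coe_le_coe.2 le_top
  have h3 : IsManifold (𝓡 2) (minSmoothness ℝ 3) M := by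
    simp only [minSmoothness_of_isRCLikeNormedField]; infer_instance
  have smoothAt {V : Π x : M, TangentSpace (𝓡 2) x} (hV : SmoothField W V) :=
    (hV.contMDiffAt (hW.mem_nhds hx)).of_le two_le
  have dg := hg.mdiff hW hx
  have J1 := leibniz_identity_mlieBracket_apply (smoothAt hX) (smoothAt hY) (smoothAt (hZ.smul hg))
  have J2 := leibniz_identity_mlieBracket_apply (smoothAt hX) (smoothAt hY) (smoothAt hZ)
  have e (V : Π x : M, TangentSpace (𝓡 2) x) : Set.EqOn (mlieBracket (𝓡 2) V (g • Z))
      (dirDeriv V g • Z + g • mlieBracket (𝓡 2) V Z) W := fun y hy =>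
    mlieBracket_smul_right' (hg.mdiff hW hy) (hZ.mdiff hW hy)
  have key {U V : Π x : M, TangentSpace (𝓡 2) x} (hV : SmoothField W V) :
      mlieBracket (𝓡 2) U (mlieBracket (𝓡 2) V (g • Z)) x
      = dirDeriv U (dirDeriv V g) x • Z x + dirDeriv V g x • mlieBracket (𝓡 2) U Z x
       + (dirDeriv U g x • mlieBracket (𝓡 2) V Z x
       + g x • mlieBracket (𝓡 2) U (mlieBracket (𝓡 2) V Z) x) := by
    rw [mlieBracket_congr hW hx (Set.eqOn_refl U W) (e V),
      mlieBracket_add_right ((hZ.smul (hg.dirDeriv hW hV)).mdiff hW hx)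
        (((hV.mlieBracket hW hZ).smul hg).mdiff hW hx),
      mlieBracket_smul_right' ((hg.dirDeriv hW hV).mdiff hW hx) (hZ.mdiff hW hx),
      mlieBracket_smul_right' dg ((hV.mlieBracket hW hZ).mdiff hW hx)]
  rw [key hY, key hX, e _ hx] at J1
  simp only [Pi.add_apply, Pi.smul_apply'] at J1
  rw [J2] at J1
  linear_combination (norm := module) (-1 : ℝ) • J1

/-- Taking for `Z` a local field that is nonzero at `x` lets the factor `Z x` be cancelled. -/
theorem dirDeriv_mlieBracket (hW : IsOpen W) (hx : x ∈ W) (hX : SmoothField W X)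
    (hY : SmoothField W Y) (hg : SmoothFun W g) :
    dirDeriv (mlieBracket (𝓡 2) X Y) g x
      = dirDeriv X (dirDeriv Y g) x - dirDeriv Y (dirDeriv X g) x := by
  set V := W ∩ (chartAt (EuclideanSpace ℝ (Fin 2)) x).source
  have hV : IsOpen V := hW.inter (chartAt (EuclideanSpace ℝ (Fin 2)) x).open_source
  have hVW : V ⊆ W := Set.inter_subset_left
  have hxV : x ∈ V := ⟨hx, mem_chart_source _ x⟩
  have h := dirDeriv_mlieBracket_smul hxV hV (hX.mono hVW) (hY.mono hVW) (hg.mono hVW)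
    ((smoothField_extend (tangentBasis x 0)).mono Set.inter_subset_right)
  rw [extend_apply_self] at h
  exact smul_left_injective ℝ ((tangentBasis x).ne_zero 0) h

end Calculus

/-! ### Covariant differentiation of local fields -/

section Covariant

variable {M : Type*} [TopologicalSpace M] [ChartedSpace (EuclideanSpace ℝ (Fin 2)) M]
  [IsManifold (𝓡 2) ∞ M]

/-- The vector field `∇_X Y`. -/
def covField (nabla : Connection M) (X Y : Π x : M, TangentSpace (𝓡 2) x) :
    Π x : M, TangentSpace (𝓡 2) x := fun x => nabla Y x (X x)

variable {nabla : Connection M} {W : Set M} {X X' Y Y' Z Z' : Π x : M, TangentSpace (𝓡 2) x}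
  {f g : M → ℝ} {x : M}

theorem curvatureField_eq_covField : curvatureField nabla X Y Z =
    covField nabla Y (covField nabla X Z) - covField nabla X (covField nabla Y Z)
      + covField nabla (mlieBracket (𝓡 2) X Y) Z := rfl

theorem covField_add_left : covField nabla (X + X') Y = covField nabla X Y + covField nabla X' Y := by
  funext x; simp [covField]

theorem covField_smul_left : covField nabla (g • X) Y = g • covField nabla X Y := by
  funext x; simp [covField]

theorem covField_congr (hW : IsOpen W) (hx : x ∈ W) (hY : SmoothField W Y)
    (h : Set.EqOn Y Y' W) : covField nabla X Y x = covField nabla X Y' x := by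
  have hY' : SmoothField W Y' := hY.congr fun y hy => by rw [h hy]
  have := nabla.isCovariantDerivativeOnUniv.congr_of_eventuallyEq (hY.mdiff hW hx)
    (hY'.mdiff hW hx) Filter.univ_mem (Filter.eventually_of_mem (hW.mem_nhds hx) h)
  exact congrArg (fun T => T (X x)) this

theorem covField_add (hW : IsOpen W) (hx : x ∈ W) (hY : SmoothField W Y) (hZ : SmoothField W Z) :
    covField nabla X (Y + Z) x = covField nabla X Y x + covField nabla X Z x := by
  have := nabla.isCovariantDerivativeOnUniv.add (hY.mdiff hW hx) (hZ.mdiff hW hx)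
  exact congrArg (fun T => T (X x)) this

theorem covField_smul (hW : IsOpen W) (hx : x ∈ W) (hg : SmoothFun W g) (hY : SmoothField W Y) :
    covField nabla X (g • Y) x = dirDeriv X g x • Y x + g x • covField nabla X Y x := by
  have := nabla.isCovariantDerivativeOnUniv.leibniz (hY.mdiff hW hx) (hg.mdiff hW hx)
  have h2 := congrArg (fun T => T (X x)) this
  refine h2.trans ?_
  simp only [dirDeriv, covField]
  rw [add_comm]
  rfl

/-- Smoothness of the connection is applied to fields smooth on all of `M`; a bump function equal to
1 near `x` reduces local fields to this case. -/
theorem exists_smoothField_univ_eqOn [T2Space M] (hW : IsOpen W) (hx : x ∈ W)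
    (hX : SmoothField W X) :
    ∃ X' : Π x : M, TangentSpace (𝓡 2) x, SmoothField Set.univ X' ∧
      ∃ V, IsOpen V ∧ x ∈ V ∧ V ⊆ W ∧ Set.EqOn X X' V := by
  obtain ⟨b, -, hb⟩ := (SmoothBumpFunction.nhds_basis_tsupport (I := 𝓡 2) x).mem_iff.1
    (hW.mem_nhds hx)
  obtain ⟨V, hV, hVo, hxV⟩ := mem_nhds_iff.1 (Filter.inter_mem b.eventuallyEq_one (hW.mem_nhds hx))
  refine ⟨(b : M → ℝ) • X, ?_, V, hVo, hxV, fun y hy => (hV hy).2, fun y hy => ?_⟩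
  · exact (ContMDiffOn.smul_section_of_tsupport (V := (TangentSpace (𝓡 2) : M → Type _))
      b.contMDiff.contMDiffOn hW hb hX).contMDiffOn
  · have : b y = 1 := (hV hy).1
    change X y = b y • X y
    rw [this, one_smul]

theorem SmoothField.covField [T2Space M]
    (hnabla : CovariantDerivative.ContMDiffCovariantDerivative nabla ∞)
    (hW : IsOpen W) (hX : SmoothField W X) (hY : SmoothField W Y) :
    SmoothField W (covField nabla X Y) := by
  intro x hx
  obtain ⟨Y', hY', V, hV, hxV, hVW, heq⟩ := exists_smoothField_univ_eqOn hW hx hY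
  have h1 := hnabla.contMDiff.contMDiff (σ := Y') (by simpa using hY')
  have h2 : SmoothField V (SurfaceConnection.covField nabla X Y') :=
    ContMDiffOn.clm_bundle_apply (E₁ := (TangentSpace (𝓡 2) : M → Type _))
    (E₂ := (TangentSpace (𝓡 2) : M → Type _)) (h1.mono (Set.subset_univ V)) (hX.mono hVW)
  have h3 : SmoothField V (SurfaceConnection.covField nabla X Y) := h2.congr fun y hy => by
    rw [covField_congr hV hy (hY.mono hVW) heq]
  exact (h3.contMDiffAt (hV.mem_nhds hxV)).contMDiffWithinAt

theorem IsRSTS.covField_sub (hnabla : IsRSTS nabla) (hW : IsOpen W) (hx : x ∈ W)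
    (hX : SmoothField W X) (hY : SmoothField W Y) :
    covField nabla X Y x - covField nabla Y X x = mlieBracket (𝓡 2) X Y x := by
  have : IsManifold (𝓡 2) 2 M := .of_le (n := ∞) (WithTop.coe_le_coe.2 le_top)
  have h := CovariantDerivative.torsion_apply nabla (hX.mdiff hW hx) (hY.mdiff hW hx)
  rw [hnabla.torsion_eq_zero] at h
  exact (sub_eq_zero.1 h.symm)

/-! ### The curvature is tensorial -/

theorem curvatureField_swap : curvatureField nabla X Y Z = -curvatureField nabla Y X Z := by
  funext x
  simp only [curvatureField, Pi.neg_apply]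
  rw [mlieBracket_swap_apply, map_neg]
  abel

theorem curvatureField_congr_left (hW : IsOpen W) (hx : x ∈ W) [T2Space M]
    (hnabla : CovariantDerivative.ContMDiffCovariantDerivative nabla ∞)
    (hX : SmoothField W X) (hZ : SmoothField W Z) (h : Set.EqOn X X' W) :
    curvatureField nabla X Y Z x = curvatureField nabla X' Y Z x := by
  simp only [curvatureField_eq_covField, Pi.add_apply, Pi.sub_apply]
  have h1 : Set.EqOn (covField nabla X Z) (covField nabla X' Z) W := fun y hy =>
    congrArg (nabla Z y) (h hy)
  rw [covField_congr hW hx (hX.covField hnabla hW hZ) h1]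
  simp only [covField]
  rw [mlieBracket_congr hW hx h (Set.eqOn_refl Y W), h hx]

theorem curvatureField_add_left (hW : IsOpen W) (hx : x ∈ W) [T2Space M]
    (hnabla : CovariantDerivative.ContMDiffCovariantDerivative nabla ∞)
    (hX : SmoothField W X) (hX' : SmoothField W X') (hZ : SmoothField W Z) :
    curvatureField nabla (X + X') Y Z x
      = curvatureField nabla X Y Z x + curvatureField nabla X' Y Z x := by
  have : IsManifold (𝓡 2) (minSmoothness ℝ 2) M := by
    simp only [minSmoothness_of_isRCLikeNormedField]; infer_instance
  simp only [curvatureField_eq_covField, Pi.add_apply, Pi.sub_apply, covField_add_left]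
  rw [covField_add hW hx (hX.covField hnabla hW hZ) (hX'.covField hnabla hW hZ)]
  simp only [covField]
  rw [mlieBracket_add_left (hX.mdiff hW hx) (hX'.mdiff hW hx), map_add]
  abel

theorem curvatureField_smul_left (hW : IsOpen W) (hx : x ∈ W) [T2Space M]
    (hnabla : CovariantDerivative.ContMDiffCovariantDerivative nabla ∞)
    (hg : SmoothFun W g) (hX : SmoothField W X) (hZ : SmoothField W Z) :
    curvatureField nabla (g • X) Y Z x = g x • curvatureField nabla X Y Z x := by
  have : IsManifold (𝓡 2) (minSmoothness ℝ 2) M := by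
    simp only [minSmoothness_of_isRCLikeNormedField]; infer_instance
  simp only [curvatureField_eq_covField, Pi.add_apply, Pi.sub_apply, covField_smul_left,
    Pi.smul_apply']
  rw [covField_smul hW hx hg (hX.covField hnabla hW hZ)]
  simp only [covField]
  rw [mlieBracket_smul_left (hg.mdiff hW hx) (hX.mdiff hW hx), map_add, map_smul, map_smul]
  simp only [dirDeriv]
  module

theorem curvatureField_congr_right (hW : IsOpen W) (hx : x ∈ W) [T2Space M]
    (hnabla : CovariantDerivative.ContMDiffCovariantDerivative nabla ∞)
    (hX : SmoothField W X) (hY : SmoothField W Y)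
    (hZ : SmoothField W Z) (h : Set.EqOn Z Z' W) :
    curvatureField nabla X Y Z x = curvatureField nabla X Y Z' x := by
  simp only [curvatureField_eq_covField, Pi.add_apply, Pi.sub_apply]
  have h1 (V : Π x : M, TangentSpace (𝓡 2) x) :
      Set.EqOn (covField nabla V Z) (covField nabla V Z') W := fun y hy =>
    covField_congr hW hy hZ h
  rw [covField_congr hW hx (hX.covField hnabla hW hZ) (h1 X),
    covField_congr hW hx (hY.covField hnabla hW hZ) (h1 Y), h1 _ hx]

theorem curvatureField_add_right (hW : IsOpen W) (hx : x ∈ W) [T2Space M]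
    (hnabla : CovariantDerivative.ContMDiffCovariantDerivative nabla ∞)
    (hX : SmoothField W X) (hY : SmoothField W Y) (hZ : SmoothField W Z) (hZ' : SmoothField W Z') :
    curvatureField nabla X Y (Z + Z') x
      = curvatureField nabla X Y Z x + curvatureField nabla X Y Z' x := by
  simp only [curvatureField_eq_covField, Pi.add_apply, Pi.sub_apply]
  have h1 (V : Π x : M, TangentSpace (𝓡 2) x) :
      Set.EqOn (covField nabla V (Z + Z')) (covField nabla V Z + covField nabla V Z') W :=
    fun y hy => covField_add hW hy hZ hZ'
  have h2 {V : Π x : M, TangentSpace (𝓡 2) x} (hV : SmoothField W V) :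
      SmoothField W (covField nabla V (Z + Z')) := hV.covField hnabla hW (hZ.add hZ')
  rw [covField_congr hW hx (h2 hX) (h1 X), covField_congr hW hx (h2 hY) (h1 Y), h1 _ hx,
    covField_add hW hx (hX.covField hnabla hW hZ) (hX.covField hnabla hW hZ'),
    covField_add hW hx (hY.covField hnabla hW hZ) (hY.covField hnabla hW hZ')]
  simp only [Pi.add_apply]
  abel

/-- The first-order terms in `g` cancel in pairs; the second-order ones amount to the commutator of
`X` and `Y` on `g`, which the bracket term of the curvature compensates. -/
theorem curvatureField_smul_right (hW : IsOpen W) (hx : x ∈ W) [T2Space M]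
    (hnabla : CovariantDerivative.ContMDiffCovariantDerivative nabla ∞)
    (hX : SmoothField W X) (hY : SmoothField W Y) (hg : SmoothFun W g) (hZ : SmoothField W Z) :
    curvatureField nabla X Y (g • Z) x = g x • curvatureField nabla X Y Z x := by
  simp only [curvatureField_eq_covField, Pi.add_apply, Pi.sub_apply]
  have h1 (V : Π x : M, TangentSpace (𝓡 2) x) :
      Set.EqOn (covField nabla V (g • Z)) (dirDeriv V g • Z + g • covField nabla V Z) W :=
    fun y hy => covField_smul hW hy hg hZ
  have h2 {V : Π x : M, TangentSpace (𝓡 2) x} (hV : SmoothField W V) :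
      SmoothField W (covField nabla V (g • Z)) := hV.covField hnabla hW (hZ.smul hg)
  rw [covField_congr hW hx (h2 hX) (h1 X), covField_congr hW hx (h2 hY) (h1 Y), h1 _ hx,
    covField_add hW hx (hZ.smul (hg.dirDeriv hW hX)) ((hX.covField hnabla hW hZ).smul hg),
    covField_add hW hx (hZ.smul (hg.dirDeriv hW hY)) ((hY.covField hnabla hW hZ).smul hg),
    covField_smul hW hx (hg.dirDeriv hW hX) hZ, covField_smul hW hx (hg.dirDeriv hW hY) hZ,
    covField_smul hW hx hg (hX.covField hnabla hW hZ),
    covField_smul hW hx hg (hY.covField hnabla hW hZ)]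
  simp only [Pi.add_apply, Pi.smul_apply', dirDeriv_mlieBracket hW hx hX hY hg]
  module

end Covariant

/-! ### Curvature of a surface with skew Ricci tensor -/

section Ricci

variable {M : Type*} [TopologicalSpace M] [ChartedSpace (EuclideanSpace ℝ (Fin 2)) M]
  [IsManifold (𝓡 2) ∞ M]

/-- The coordinate vector fields of the preferred chart at `x₀`. -/
def chartFrame (x₀ : M) (i : Fin 2) : Π x : M, TangentSpace (𝓡 2) x :=
  (trivializationAt (EuclideanSpace ℝ (Fin 2)) (TangentSpace (𝓡 2) : M → Type _)
    x₀).localFrame (EuclideanSpace.basisFun (Fin 2) ℝ).toBasis i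

/-- The components with respect to `chartFrame x₀`. -/
def chartCoeff (x₀ : M) (i : Fin 2) (x : M) : TangentSpace (𝓡 2) x →ₗ[ℝ] ℝ :=
  (trivializationAt (EuclideanSpace ℝ (Fin 2)) (TangentSpace (𝓡 2) : M → Type _)
    x₀).localFrameCoeff (𝓡 2) (EuclideanSpace.basisFun (Fin 2) ℝ).toBasis i x

/-- The domain of `chartFrame x₀`. -/
abbrev chartDomain (x₀ : M) : Set M := (chartAt (EuclideanSpace ℝ (Fin 2)) x₀).source

theorem isOpen_chartDomain (x₀ : M) : IsOpen (chartDomain x₀) :=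
  (chartAt (EuclideanSpace ℝ (Fin 2)) x₀).open_source

theorem mem_chartDomain (x₀ : M) : x₀ ∈ chartDomain x₀ := mem_chart_source _ x₀

theorem smoothField_chartFrame (x₀ : M) (i : Fin 2) :
    SmoothField (chartDomain x₀) (chartFrame x₀ i) :=
  (trivializationAt (EuclideanSpace ℝ (Fin 2)) (TangentSpace (𝓡 2) : M → Type _)
    x₀).contMDiffOn_localFrame_baseSet (I := 𝓡 2) ∞ _ i

variable {W : Set M} {X X' Y Y' Z Z' : Π x : M, TangentSpace (𝓡 2) x} {f g : M → ℝ} {x₀ x : M}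
  {nabla : Connection M}

theorem smoothFun_chartCoeff (hW : IsOpen W) (hW' : W ⊆ chartDomain x₀) (hX : SmoothField W X)
    (i : Fin 2) : SmoothFun W (fun x => chartCoeff x₀ i x (X x)) :=
  contMDiffOn_localFrameCoeff (V := (TangentSpace (𝓡 2) : M → Type _)) _ hW hW' hX i

theorem eq_chartCoeff_smul (hx : x ∈ chartDomain x₀) (u : TangentSpace (𝓡 2) x) :
    u = chartCoeff x₀ 0 x u • chartFrame x₀ 0 x + chartCoeff x₀ 1 x u • chartFrame x₀ 1 x := by
  have h := Trivialization.eq_sum_localFrameCoeff_smul (I := 𝓡 2)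
    (V := (TangentSpace (𝓡 2) : M → Type _))
    (e := trivializationAt (EuclideanSpace ℝ (Fin 2)) (TangentSpace (𝓡 2) : M → Type _) x₀)
    (b := (EuclideanSpace.basisFun (Fin 2) ℝ).toBasis)
    (s := extend (EuclideanSpace ℝ (Fin 2)) u) (x' := x) hx
  rw [Fin.sum_univ_two, extend_apply_self] at h
  exact h

theorem chartCoeff_chartFrame (hx : x ∈ chartDomain x₀) (i j : Fin 2) :
    chartCoeff x₀ i x (chartFrame x₀ j x) = if i = j then 1 else 0 := by
  have h := Trivialization.localFrameCoeff_apply_of_mem_baseSet (I := 𝓡 2)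
    (V := (TangentSpace (𝓡 2) : M → Type _))
    (trivializationAt (EuclideanSpace ℝ (Fin 2)) (TangentSpace (𝓡 2) : M → Type _) x₀)
    (EuclideanSpace.basisFun (Fin 2) ℝ).toBasis (x := x) hx (chartFrame x₀ j) i
  refine h.trans ?_
  rw [chartFrame, Trivialization.localFrame_apply_of_mem_baseSet _ _ hx]
  simp [Finsupp.single_apply, eq_comm]

/-- The components of the curvature tensor in the frame `chartFrame x`, at `x`. -/
def curvatureComp (nabla : Connection M) (x : M) (i j k : Fin 2) : TangentSpace (𝓡 2) x :=
  curvatureField nabla (chartFrame x i) (chartFrame x j) (chartFrame x k) x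

/-- Expansion of all three slots in a local frame; the middle slot follows from the first by
skew-symmetry. The right side depends only on the values at `x`, so extensions are immaterial. -/
theorem curvatureField_eq_sum [T2Space M]
    (hnabla : CovariantDerivative.ContMDiffCovariantDerivative nabla ∞)
    (hW : IsOpen W) (hx : x ∈ W)
    (hX : SmoothField W X) (hY : SmoothField W Y) (hZ : SmoothField W Z) :
    curvatureField nabla X Y Z x = ∑ i, ∑ j, ∑ k,
      (chartCoeff x i x (X x) * chartCoeff x j x (Y x) * chartCoeff x k x (Z x)) •
        curvatureComp nabla x i j k := by
  set V := W ∩ chartDomain x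
  have hV : IsOpen V := hW.inter (isOpen_chartDomain x)
  have hVW : V ⊆ W := Set.inter_subset_left
  have hVc : V ⊆ chartDomain x := Set.inter_subset_right
  have hxV : x ∈ V := ⟨hx, mem_chartDomain x⟩
  have hE (i) : SmoothField V (chartFrame x i) := (smoothField_chartFrame x i).mono hVc
  have left {T Y Z : Π x : M, TangentSpace (𝓡 2) x} (hT : SmoothField V T) (hY : SmoothField V Y)
      (hZ : SmoothField V Z) : curvatureField nabla T Y Z x =
        ∑ i, chartCoeff x i x (T x) • curvatureField nabla (chartFrame x i) Y Z x := by
    have hc (i) := smoothFun_chartCoeff hV hVc hT i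
    rw [curvatureField_congr_left hV hxV hnabla hT hZ
      (fun y hy => eq_chartCoeff_smul (hVc hy) (T y)), Fin.sum_univ_two]
    refine (curvatureField_add_left hV hxV hnabla ((hE 0).smul (hc 0)) ((hE 1).smul (hc 1))
      hZ).trans ?_
    rw [curvatureField_smul_left hV hxV hnabla (hc 0) (hE 0) hZ,
      curvatureField_smul_left hV hxV hnabla (hc 1) (hE 1) hZ]
  have middle {T X Z : Π x : M, TangentSpace (𝓡 2) x} (hT : SmoothField V T) (hX : SmoothField V X)
      (hZ : SmoothField V Z) : curvatureField nabla X T Z x =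
        ∑ i, chartCoeff x i x (T x) • curvatureField nabla X (chartFrame x i) Z x := by
    rw [curvatureField_swap, Pi.neg_apply, left hT hX hZ, ← Finset.sum_neg_distrib]
    refine Finset.sum_congr rfl fun i _ => ?_
    rw [curvatureField_swap, Pi.neg_apply, smul_neg, neg_neg]
  have right {T X Y : Π x : M, TangentSpace (𝓡 2) x} (hT : SmoothField V T) (hX : SmoothField V X)
      (hY : SmoothField V Y) : curvatureField nabla X Y T x =
        ∑ i, chartCoeff x i x (T x) • curvatureField nabla X Y (chartFrame x i) x := by
    have hc (i) := smoothFun_chartCoeff hV hVc hT i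
    rw [curvatureField_congr_right hV hxV hnabla hX hY hT
      (fun y hy => eq_chartCoeff_smul (hVc hy) (T y)), Fin.sum_univ_two]
    refine (curvatureField_add_right hV hxV hnabla hX hY ((hE 0).smul (hc 0))
      ((hE 1).smul (hc 1))).trans ?_
    rw [curvatureField_smul_right hV hxV hnabla hX hY (hc 0) (hE 0),
      curvatureField_smul_right hV hxV hnabla hX hY (hc 1) (hE 1)]
  rw [left (hX.mono hVW) (hY.mono hVW) (hZ.mono hVW)]
  refine Finset.sum_congr rfl fun i _ => ?_
  rw [middle (hY.mono hVW) (hE i) (hZ.mono hVW), Finset.smul_sum]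
  refine Finset.sum_congr rfl fun j _ => ?_
  rw [right (hZ.mono hVW) (hE i) (hE j), Finset.smul_sum, Finset.smul_sum]
  refine Finset.sum_congr rfl fun k _ => ?_
  rw [smul_smul, smul_smul, curvatureComp, mul_assoc]

theorem curvature_eq_sum [T2Space M]
    (hnabla : CovariantDerivative.ContMDiffCovariantDerivative nabla ∞)
    (u v z : TangentSpace (𝓡 2) x) :
    curvature nabla x u v z = ∑ i, ∑ j, ∑ k,
      (chartCoeff x i x u * chartCoeff x j x v * chartCoeff x k x z) •
        curvatureComp nabla x i j k := by
  rw [curvature, curvatureField_eq_sum hnabla (isOpen_chartDomain x) (mem_chartDomain x)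
    (smoothField_extend u) (smoothField_extend v) (smoothField_extend z)]
  simp only [extend_apply_self]

theorem curvatureField_eq_curvature [T2Space M]
    (hnabla : CovariantDerivative.ContMDiffCovariantDerivative nabla ∞)
    (hW : IsOpen W) (hx : x ∈ W)
    (hX : SmoothField W X) (hY : SmoothField W Y) (hZ : SmoothField W Z) :
    curvatureField nabla X Y Z x = curvature nabla x (X x) (Y x) (Z x) := by
  rw [curvatureField_eq_sum hnabla hW hx hX hY hZ, curvature_eq_sum hnabla]

theorem curvature_swap (u v z : TangentSpace (𝓡 2) x) :
    curvature nabla x u v z = -curvature nabla x v u z := by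
  simp only [curvature]
  rw [curvatureField_swap, Pi.neg_apply]

theorem curvature_isTrilinear [T2Space M]
    (hnabla : CovariantDerivative.ContMDiffCovariantDerivative nabla ∞) (x : M) :
    ∃ T : TangentSpace (𝓡 2) x →ₗ[ℝ] TangentSpace (𝓡 2) x →ₗ[ℝ] TangentSpace (𝓡 2) x →ₗ[ℝ]
      TangentSpace (𝓡 2) x, ∀ u v z, curvature nabla x u v z = T u v z := by
  refine ⟨∑ i, ∑ j, ∑ k, (chartCoeff x i x).smulRight ((chartCoeff x j x).smulRight
    ((chartCoeff x k x).smulRight (curvatureComp nabla x i j k))), fun u v z => ?_⟩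
  rw [curvature_eq_sum hnabla]
  simp [smul_smul]

/-- By skew-symmetry `T` is determined by the endomorphism `A = T (b 0) (b 1)`. The contractions on
`(b 0, b 0)` and `(b 1, b 1)` are, up to sign, the off-diagonal entries of `A`, hence zero; skewness
on `(b 0, b 1)` equates the diagonal entries. So `A` is a scalar `c`. -/
theorem exists_area_of_trilinear {E : Type*} [AddCommGroup E] [Module ℝ E]
    (b : Module.Basis (Fin 2) ℝ E) (T : E →ₗ[ℝ] E →ₗ[ℝ] E →ₗ[ℝ] E)
    (hs : ∀ u v z, T u v z = -T v u z)
    (hr : ∀ u w, ∑ i, b.coord i (T u (b i) w) = -∑ i, b.coord i (T w (b i) u)) :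
    ∃ c : ℝ, ∀ u v, ∑ i, b.coord i (T u (b i) v)
        = c * (b.coord 0 u * b.coord 1 v - b.coord 1 u * b.coord 0 v) ∧
      ∀ z, T u v z = (c * (b.coord 0 u * b.coord 1 v - b.coord 1 u * b.coord 0 v)) • z := by
  have rep (u : E) : u = b.coord 0 u • b 0 + b.coord 1 u • b 1 := by
    conv_lhs => rw [← b.sum_repr u, Fin.sum_univ_two]
    rfl
  have alt (u z) : T u u z = 0 := by
    have h := hs u u z
    have h2 : (2 : ℝ) • T u u z = 0 := by rw [two_smul]; nth_rewrite 1 [h]; simp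
    exact (smul_eq_zero.1 h2).resolve_left two_ne_zero
  have h10 (z) : T (b 1) (b 0) z = -T (b 0) (b 1) z := hs _ _ z
  simp only [Fin.sum_univ_two] at hr ⊢
  have e1 := hr (b 0) (b 0)
  have e2 := hr (b 1) (b 1)
  have e3 := hr (b 0) (b 1)
  simp only [alt, h10, map_neg, map_zero] at e1 e2 e3
  have k0 : b.coord 1 (T (b 0) (b 1) (b 0)) = 0 := by linarith
  have k1 : b.coord 0 (T (b 0) (b 1) (b 1)) = 0 := by linarith
  have k2 : b.coord 1 (T (b 0) (b 1) (b 1)) = b.coord 0 (T (b 0) (b 1) (b 0)) := by linarith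
  set c := b.coord 0 (T (b 0) (b 1) (b 0)) with hc
  have r0 := rep (T (b 0) (b 1) (b 0))
  have r1 := rep (T (b 0) (b 1) (b 1))
  rw [k0, ← hc, zero_smul, add_zero] at r0
  rw [k1, k2, zero_smul, zero_add] at r1
  have r (z) : T (b 0) (b 1) z = c • z := by
    conv_lhs => rw [rep z]
    conv_rhs => rw [rep z]
    rw [map_add, map_smul, map_smul, r0, r1]
    module
  have key (u v z) : T u v z = (c * (b.coord 0 u * b.coord 1 v - b.coord 1 u * b.coord 0 v)) • z := by
    conv_lhs => rw [rep u, rep v]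
    simp only [map_add, map_smul, LinearMap.add_apply, LinearMap.smul_apply, alt, h10, r]
    module
  refine ⟨c, fun u v => ⟨?_, key u v⟩⟩
  rw [key, key]
  simp
  ring

theorem IsRSTS.exists_area [T2Space M] (hnabla : IsRSTS nabla) (x : M) :
    ∃ c : ℝ, ∀ u v, ricci nabla x u v = c * ((tangentBasis x).coord 0 u * (tangentBasis x).coord 1 v
        - (tangentBasis x).coord 1 u * (tangentBasis x).coord 0 v) ∧
      ∀ z, curvature nabla x u v z = ricci nabla x u v • z := by
  obtain ⟨T, hT⟩ := curvature_isTrilinear hnabla.smooth x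
  obtain ⟨c, hc⟩ := exists_area_of_trilinear (tangentBasis x) T
    (fun u v z => by rw [← hT, ← hT, curvature_swap])
    (fun u w => by simp only [← hT]; exact hnabla.ricci_skew x u w)
  simp only [← hT] at hc
  refine ⟨c, fun u v => ⟨(hc u v).1, fun z => ?_⟩⟩
  rw [(hc u v).2, ricci, (hc u v).1]

theorem IsRSTS.curvature_eq [T2Space M] (hnabla : IsRSTS nabla) (u v z : TangentSpace (𝓡 2) x) :
    curvature nabla x u v z = ricci nabla x u v • z := by
  obtain ⟨c, hc⟩ := hnabla.exists_area x
  exact (hc u v).2 z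

theorem IsRSTS.ricci_self (hnabla : IsRSTS nabla) (u : TangentSpace (𝓡 2) x) :
    ricci nabla x u u = 0 := by
  linarith [hnabla.ricci_skew x u u]

theorem IsRSTS.ricci_add_right [T2Space M] (hnabla : IsRSTS nabla)
    (u v w : TangentSpace (𝓡 2) x) :
    ricci nabla x u (v + w) = ricci nabla x u v + ricci nabla x u w := by
  obtain ⟨c, hc⟩ := hnabla.exists_area x
  simp only [fun u v => (hc u v).1, map_add]
  ring

theorem IsRSTS.ricci_smul_right [T2Space M] (hnabla : IsRSTS nabla) (a : ℝ)
    (u v : TangentSpace (𝓡 2) x) : ricci nabla x u (a • v) = a * ricci nabla x u v := by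
  obtain ⟨c, hc⟩ := hnabla.exists_area x
  simp only [fun u v => (hc u v).1, map_smul, smul_eq_mul]
  ring

theorem IsRSTS.ricci_add_left [T2Space M] (hnabla : IsRSTS nabla)
    (u v w : TangentSpace (𝓡 2) x) :
    ricci nabla x (u + v) w = ricci nabla x u w + ricci nabla x v w := by
  obtain ⟨c, hc⟩ := hnabla.exists_area x
  simp only [fun u v => (hc u v).1, map_add]
  ring

theorem IsRSTS.ricci_smul_left [T2Space M] (hnabla : IsRSTS nabla) (a : ℝ)
    (u v : TangentSpace (𝓡 2) x) : ricci nabla x (a • u) v = a * ricci nabla x u v := by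
  obtain ⟨c, hc⟩ := hnabla.exists_area x
  simp only [fun u v => (hc u v).1, map_smul, smul_eq_mul]
  ring

/-- Cramer's rule in a plane: it holds for every multiple of the area form. Throughout, it replaces
arguments with bases. -/
theorem IsRSTS.ricci_cyclic [T2Space M] (hnabla : IsRSTS nabla) (u v z : TangentSpace (𝓡 2) x) :
    ricci nabla x u v • z = ricci nabla x z v • u + ricci nabla x u z • v := by
  obtain ⟨c, hc⟩ := hnabla.exists_area x
  refine (tangentBasis x).ext_elem fun i => ?_
  rw [← Module.Basis.coord_apply, ← Module.Basis.coord_apply]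
  simp only [fun u v => (hc u v).1, map_add, map_smul, smul_eq_mul]
  fin_cases i <;> simp only [Fin.zero_eta, Fin.mk_one] <;> ring

theorem IsRSTS.curvatureField_eq [T2Space M] (hnabla : IsRSTS nabla) (hW : IsOpen W) (hx : x ∈ W)
    (hX : SmoothField W X) (hY : SmoothField W Y) (hZ : SmoothField W Z) :
    curvatureField nabla X Y Z x = ricci nabla x (X x) (Y x) • Z x := by
  rw [curvatureField_eq_curvature hnabla.smooth hW hx hX hY hZ, hnabla.curvature_eq]

theorem SmoothField.curvatureField [T2Space M]
    (hnabla : CovariantDerivative.ContMDiffCovariantDerivative nabla ∞) (hW : IsOpen W)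
    (hX : SmoothField W X) (hY : SmoothField W Y) (hZ : SmoothField W Z) :
    SmoothField W (curvatureField nabla X Y Z) := by
  rw [curvatureField_eq_covField]
  exact ((hY.covField hnabla hW (hX.covField hnabla hW hZ)).sub
    (hX.covField hnabla hW (hY.covField hnabla hW hZ))).add
    ((hX.mlieBracket hW hY).covField hnabla hW hZ)

/-- Since `R(X, Y) E = ρ(X, Y) E`, the function `ρ(X, Y)` is a frame coefficient of a smooth field
when `E` is a frame field. -/
theorem IsRSTS.smoothFun_ricci [T2Space M] (hnabla : IsRSTS nabla) (hW : IsOpen W)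
    (hX : SmoothField W X) (hY : SmoothField W Y) :
    SmoothFun W (fun x => ricci nabla x (X x) (Y x)) := by
  intro x hx
  set V := W ∩ chartDomain x
  have hV : IsOpen V := hW.inter (isOpen_chartDomain x)
  have hVW : V ⊆ W := Set.inter_subset_left
  have hVc : V ⊆ chartDomain x := Set.inter_subset_right
  have hxV : x ∈ V := ⟨hx, mem_chartDomain x⟩
  have hE := (smoothField_chartFrame x 0).mono hVc
  have h : SmoothFun V (fun x => ricci nabla x (X x) (Y x)) := by
    refine (smoothFun_chartCoeff hV hVc (SmoothField.curvatureField hnabla.smooth hV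
      (hX.mono hVW) (hY.mono hVW) hE) 0).congr fun y hy => ?_
    rw [hnabla.curvatureField_eq hV hy (hX.mono hVW) (hY.mono hVW) hE, map_smul,
      chartCoeff_chartFrame (hVc hy)]
    simp
  exact (h.contMDiffAt (hV.mem_nhds hxV)).contMDiffWithinAt

end Ricci

/-! ### Killing forms and their prolongation -/

section Killing

variable {M : Type*} [TopologicalSpace M] [ChartedSpace (EuclideanSpace ℝ (Fin 2)) M]
  [IsManifold (𝓡 2) ∞ M]

/-- The value of a 1-form at a point, as a linear functional. -/
def evalAt (ξ : OneForm M) (x : M) : TangentSpace (𝓡 2) x →L[ℝ] ℝ := ξ x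

/-- The function `ξ(X)`. -/
def pairing (ξ : OneForm M) (X : Π x : M, TangentSpace (𝓡 2) x) : M → ℝ :=
  fun x => evalAt ξ x (X x)

variable {W : Set M} {X X' Y Y' Z Z' : Π x : M, TangentSpace (𝓡 2) x} {f g : M → ℝ} {x : M}
  {nabla : Connection M} {ξ : OneForm M}

theorem smoothFun_pairing (ξ : OneForm M) (hX : SmoothField W X) : SmoothFun W (pairing ξ X) := by
  intro x hx
  have h2 := ContMDiffWithinAt.clm_bundle_apply (F₁ := EuclideanSpace ℝ (Fin 2)) (F₂ := ℝ)
    (E₁ := (TangentSpace (𝓡 2) : M → Type _)) (E₂ := Trivial M ℝ) (b := id)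
    (ϕ := fun y => ξ y) (v := X) (ξ.contMDiff x).contMDiffWithinAt (hX x hx)
  have h3 := (contMDiffWithinAt_section (F := ℝ) (E := Trivial M ℝ) (IB := 𝓡 2)).1 h2
  exact h3

theorem covDerivForm_field (hW : IsOpen W) (hx : x ∈ W) (hY : SmoothField W Y) :
    covDerivForm nabla ξ x (X x) (Y x)
      = dirDeriv X (pairing ξ Y) x - evalAt ξ x (covField nabla X Y x) :=
  covDerivForm_apply nabla ξ (X x) (hY.mdiff hW hx)

theorem smoothFun_covDerivForm [T2Space M]
    (hnabla : CovariantDerivative.ContMDiffCovariantDerivative nabla ∞) (ξ : OneForm M)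
    (hW : IsOpen W) (hX : SmoothField W X) (hY : SmoothField W Y) :
    SmoothFun W (fun x => covDerivForm nabla ξ x (X x) (Y x)) :=
  (((smoothFun_pairing ξ hY).dirDeriv hW hX).sub
    (smoothFun_pairing ξ (hX.covField hnabla hW hY))).congr fun _ hy => covDerivForm_field hW hy hY

theorem covDerivForm_add_left (ξ : OneForm M) (u v w : TangentSpace (𝓡 2) x) :
    covDerivForm nabla ξ x (u + v) w = covDerivForm nabla ξ x u w + covDerivForm nabla ξ x v w := by
  simp only [covDerivForm, map_add]
  ring

theorem covDerivForm_smul_left (ξ : OneForm M) (a : ℝ) (u w : TangentSpace (𝓡 2) x) :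
    covDerivForm nabla ξ x (a • u) w = a * covDerivForm nabla ξ x u w := by
  simp only [covDerivForm, map_smul]
  simp only [smul_eq_mul]
  ring

theorem covDerivForm_skew (hξ : ξ ∈ killingKernel nabla) (u v : TangentSpace (𝓡 2) x) :
    covDerivForm nabla ξ x u v = -covDerivForm nabla ξ x v u := by
  have h : killingOperator nabla ξ x u v = 0 := hξ x u v
  rw [killingOperator] at h
  linarith

theorem covDerivForm_self (hξ : ξ ∈ killingKernel nabla) (u : TangentSpace (𝓡 2) x) :
    covDerivForm nabla ξ x u u = 0 := by
  linarith [covDerivForm_skew hξ u u]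

theorem covDerivForm_add_right (hξ : ξ ∈ killingKernel nabla) (u v w : TangentSpace (𝓡 2) x) :
    covDerivForm nabla ξ x u (v + w) = covDerivForm nabla ξ x u v + covDerivForm nabla ξ x u w := by
  rw [covDerivForm_skew hξ, covDerivForm_add_left, covDerivForm_skew hξ u v,
    covDerivForm_skew hξ u w]
  ring

theorem covDerivForm_smul_right (hξ : ξ ∈ killingKernel nabla) (a : ℝ)
    (u v : TangentSpace (𝓡 2) x) :
    covDerivForm nabla ξ x u (a • v) = a * covDerivForm nabla ξ x u v := by
  rw [covDerivForm_skew hξ, covDerivForm_smul_left, covDerivForm_skew hξ u v]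
  ring

/-- The second covariant derivative `(∇_Z ∇ξ)(X, Y)`. -/
def secondCovDeriv (nabla : Connection M) (ξ : OneForm M) (Z X Y : Π x : M, TangentSpace (𝓡 2) x)
    (x : M) : ℝ :=
  dirDeriv Z (fun x => covDerivForm nabla ξ x (X x) (Y x)) x
    - covDerivForm nabla ξ x (covField nabla Z X x) (Y x)
    - covDerivForm nabla ξ x (X x) (covField nabla Z Y x)

theorem dirDeriv_neg_eq : dirDeriv X (-f) x = -dirDeriv X f x := by
  simp only [dirDeriv]
  rw [mvfderiv_neg]
  rfl

theorem secondCovDeriv_skew (hξ : ξ ∈ killingKernel nabla) :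
    secondCovDeriv nabla ξ Z X Y x = -secondCovDeriv nabla ξ Z Y X x := by
  have h : (fun x => covDerivForm nabla ξ x (X x) (Y x))
      = -fun x => covDerivForm nabla ξ x (Y x) (X x) := funext fun y => covDerivForm_skew hξ _ _
  simp only [secondCovDeriv, h, dirDeriv_neg_eq]
  rw [covDerivForm_skew hξ (covField nabla Z X x), covDerivForm_skew hξ (X x)]
  ring

/-- The Ricci identity for 1-forms, `ξ(R(Z, X) Y)` being `ρ(Z, X) ξ(Y)`. Vanishing torsion converts
`∇_Z X - ∇_X Z` into the bracket. -/
theorem secondCovDeriv_sub [T2Space M] (hnabla : IsRSTS nabla) (hW : IsOpen W) (hx : x ∈ W)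
    (hX : SmoothField W X) (hY : SmoothField W Y) (hZ : SmoothField W Z) :
    secondCovDeriv nabla ξ Z X Y x - secondCovDeriv nabla ξ X Z Y x
      = ricci nabla x (Z x) (X x) * evalAt ξ x (Y x) := by
  have hs := hnabla.smooth
  have e (V V' : Π x : M, TangentSpace (𝓡 2) x) (hV' : SmoothField W V') :
      dirDeriv V (fun x => covDerivForm nabla ξ x (V' x) (Y x)) x
      = dirDeriv V (dirDeriv V' (pairing ξ Y)) x
        - dirDeriv V (pairing ξ (covField nabla V' Y)) x := by
    rw [dirDeriv_congr hW hx (g := dirDeriv V' (pairing ξ Y) - pairing ξ (covField nabla V' Y))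
      fun y hy => covDerivForm_field hW hy hY,
      dirDeriv_sub (((smoothFun_pairing ξ hY).dirDeriv hW hV').mdiff hW hx)
      ((smoothFun_pairing ξ (hV'.covField hs hW hY)).mdiff hW hx)]
  have t := congrArg (fun u => covDerivForm nabla ξ x u (Y x)) (hnabla.covField_sub hW hx hZ hX)
  simp only [sub_eq_add_neg (covField nabla Z X x)] at t
  rw [covDerivForm_add_left, ← neg_one_smul ℝ, covDerivForm_smul_left,
    covDerivForm_field (X := mlieBracket (𝓡 2) Z X) hW hx hY, dirDeriv_mlieBracket hW hx hZ hX (smoothFun_pairing ξ hY)] at t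
  have c := hnabla.curvatureField_eq hW hx hZ hX hY
  rw [curvatureField_eq_covField] at c
  have c' := congrArg (evalAt ξ x) c
  simp only [Pi.add_apply, Pi.sub_apply, map_add, map_sub, map_smul, smul_eq_mul] at c'
  simp only [secondCovDeriv]
  rw [e Z X hX, e X Z hZ, covDerivForm_field (X := Z) hW hx (hX.covField hs hW hY),
    covDerivForm_field (X := X) hW hx (hZ.covField hs hW hY)]
  linarith

/-- The Killing equation expresses the derivative of `∇ξ` through `ξ`. -/
theorem secondCovDeriv_eq [T2Space M] (hnabla : IsRSTS nabla) (hξ : ξ ∈ killingKernel nabla)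
    (hW : IsOpen W) (hx : x ∈ W)
    (hX : SmoothField W X) (hY : SmoothField W Y) (hZ : SmoothField W Z) :
    secondCovDeriv nabla ξ Z X Y x = -(ricci nabla x (X x) (Y x) * evalAt ξ x (Z x)) := by
  -- As in the Koszul formula, the alternating sum `s1 - s2 + s3` of permuted Ricci identities
  -- isolates `2 (∇_Z ∇ξ)(X, Y)`, by skewness in the last two slots; the cyclic identity turns the
  -- right side into `-2 ρ(X, Y) ξ(Z)`.
  have s1 := secondCovDeriv_sub hnabla (ξ := ξ) hW hx hX hY hZ
  have s2 := secondCovDeriv_sub hnabla (ξ := ξ) hW hx hY hZ hX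
  have s3 := secondCovDeriv_sub hnabla (ξ := ξ) hW hx hZ hX hY
  have k1 := secondCovDeriv_skew (x := x) (Z := X) (X := Z) (Y := Y) hξ
  have k2 := secondCovDeriv_skew (x := x) (Z := Y) (X := X) (Y := Z) hξ
  have k3 := secondCovDeriv_skew (x := x) (Z := Z) (X := X) (Y := Y) hξ
  have c := congrArg (evalAt ξ x) (hnabla.ricci_cyclic (X x) (Y x) (Z x))
  simp only [map_add, map_smul, smul_eq_mul] at c
  have r := hnabla.ricci_skew x (Z x) (Y x)
  have r' := hnabla.ricci_skew x (Z x) (X x)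
  rw [r] at c
  rw [r'] at s1
  linarith

end Killing

/-! ### Structure equations in a frame adapted to a Killing form -/

section Frame

variable {M : Type*} [TopologicalSpace M] [ChartedSpace (EuclideanSpace ℝ (Fin 2)) M]
  [IsManifold (𝓡 2) ∞ M]

/-- A smooth frame `v, e` on an open set, adapted to a Killing form `ξ`. -/
structure IsKillingFrame (nabla : Connection M) (ξ : OneForm M) (W : Set M)
    (v e : Π x : M, TangentSpace (𝓡 2) x) (ψ : M → ℝ) : Prop where
  isOpen : IsOpen W
  smooth_v : SmoothField W v
  smooth_e : SmoothField W e
  smooth_psi : SmoothFun W ψ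
  psi_ne_zero : ∀ x ∈ W, ψ x ≠ 0
  eval_v : ∀ x ∈ W, evalAt ξ x (v x) = 0
  eval_e : ∀ x ∈ W, evalAt ξ x (e x) = ψ x
  ricci_v_e : ∀ x ∈ W, ricci nabla x (v x) (e x) = 4 * ψ x
  deriv_v_e : ∀ x ∈ W, covDerivForm nabla ξ x (v x) (e x) = ψ x ^ 2

variable {W : Set M} {v e X : Π x : M, TangentSpace (𝓡 2) x} {a p m q ψ : M → ℝ} {x : M}
  {nabla : Connection M} {ξ : OneForm M}

/-- Cramer's rule for `ρ`; the coefficient of `e` is rewritten through `ξ`, because `ρ(v, ·) = 4ξ`.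
-/
theorem IsKillingFrame.eq_combination [T2Space M] (h : IsKillingFrame nabla ξ W v e ψ)
    (hnabla : IsRSTS nabla) (hx : x ∈ W) (u : TangentSpace (𝓡 2) x) :
    u = (ricci nabla x u (e x) / (4 * ψ x)) • v x + (evalAt ξ x u / ψ x) • e x := by
  have hψ := h.psi_ne_zero x hx
  have c := hnabla.ricci_cyclic (v x) (e x) u
  have c' := congrArg (evalAt ξ x) c
  simp only [map_add, map_smul, smul_eq_mul, h.eval_v x hx, h.eval_e x hx, mul_zero, zero_add]
    at c'
  rw [h.ricci_v_e x hx] at c c'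
  have hd : evalAt ξ x u / ψ x = ricci nabla x (v x) u / (4 * ψ x) := by
    rw [div_eq_div_iff hψ (mul_ne_zero four_ne_zero hψ)]
    linear_combination c'
  have h4 : (4 * ψ x) ≠ 0 := by simpa using hψ
  rw [hd, ← smul_right_injective _ h4 |>.eq_iff]
  simp only [smul_add, smul_smul]
  rw [c]
  congr 2 <;> field_simp

theorem IsKillingFrame.eq_of_combination_eq [T2Space M] (h : IsKillingFrame nabla ξ W v e ψ)
    (hnabla : IsRSTS nabla) (hx : x ∈ W) {s t s' t' : ℝ}
    (heq : s • v x + t • e x = s' • v x + t' • e x) : s = s' ∧ t = t' := by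
  have hψ := h.psi_ne_zero x hx
  have h1 := congrArg (evalAt ξ x) heq
  have h2 := congrArg (fun u => ricci nabla x u (e x)) heq
  simp only [hnabla.ricci_add_left, hnabla.ricci_smul_left, hnabla.ricci_self,
    h.ricci_v_e x hx, mul_zero, add_zero] at h2
  simp only [map_add, map_smul, smul_eq_mul, h.eval_v x hx, h.eval_e x hx, mul_zero, zero_add]
    at h1
  exact ⟨mul_right_cancel₀ (mul_ne_zero four_ne_zero hψ) h2, mul_right_cancel₀ hψ h1⟩

/-- The structure equations of a connection in a Killing frame. -/
structure HasStructureEqs (nabla : Connection M) (W : Set M)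
    (v e : Π x : M, TangentSpace (𝓡 2) x) (ψ a p m q : M → ℝ) : Prop where
  smooth_a : SmoothFun W a
  smooth_p : SmoothFun W p
  smooth_m : SmoothFun W m
  smooth_q : SmoothFun W q
  v_v : ∀ x ∈ W, covField nabla v v x = a x • v x
  e_v : ∀ x ∈ W, covField nabla e v x = p x • v x + ψ x • e x
  v_e : ∀ x ∈ W, covField nabla v e x = m x • v x + (a x - 2 * ψ x) • e x
  e_e : ∀ x ∈ W, covField nabla e e x = q x • v x + (p x - 4) • e x
  v_psi : ∀ x ∈ W, dirDeriv v ψ x = (a x - ψ x) * ψ x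
  e_psi : ∀ x ∈ W, dirDeriv e ψ x = (p x - 4) * ψ x

/-- The `e`-components of the four derivatives are read from `∇ξ`, known on the frame, in terms of
`ψ` and `dψ`; the `v`-components are the unknowns `a, p, m, q`. The prolongation equation along `v`
and `e`, applied to `∇ξ(v, e) = ψ²`, then gives `dψ`. -/
theorem IsKillingFrame.exists_structureEqs [T2Space M] (h : IsKillingFrame nabla ξ W v e ψ)
    (hnabla : IsRSTS nabla) (hξ : ξ ∈ killingKernel nabla) :
    ∃ a p m q : M → ℝ, HasStructureEqs nabla W v e ψ a p m q := by
  have hW := h.isOpen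
  have hv := h.smooth_v
  have he := h.smooth_e
  have hs := hnabla.smooth
  -- The `v`-coefficient of a field is `ρ(·, e)/(4ψ)`, a smooth function.
  have smooth {X : Π x : M, TangentSpace (𝓡 2) x} (hX : SmoothField W X) :
      SmoothFun W (fun x => ricci nabla x (X x) (e x) / (4 * ψ x)) := by
    have h4 : SmoothFun W (fun x => 4 * ψ x) := contMDiffOn_const.mul h.smooth_psi
    exact (hnabla.smoothFun_ricci hW hX he).div₀ h4
      fun x hx => mul_ne_zero four_ne_zero (h.psi_ne_zero x hx)
  have key : ∀ x ∈ W, evalAt ξ x (covField nabla v v x) = 0 ∧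
      evalAt ξ x (covField nabla e v x) = ψ x ^ 2 ∧
      evalAt ξ x (covField nabla v e x) = dirDeriv v ψ x - ψ x ^ 2 ∧
      evalAt ξ x (covField nabla e e x) = dirDeriv e ψ x := fun x hx => by
    have z : dirDeriv v (pairing ξ v) x = 0 ∧ dirDeriv e (pairing ξ v) x = 0 := by
      have (X : Π x : M, TangentSpace (𝓡 2) x) : dirDeriv X (pairing ξ v) x = 0 := by
        rw [dirDeriv_congr hW hx (f := pairing ξ v) (g := fun _ => 0) fun y hy => h.eval_v y hy,
          dirDeriv_const]
      exact ⟨this v, this e⟩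
    have z' (X : Π x : M, TangentSpace (𝓡 2) x) :
        dirDeriv X (pairing ξ e) x = dirDeriv X ψ x :=
      dirDeriv_congr hW hx fun y hy => h.eval_e y hy
    have e1 := covDerivForm_field (nabla := nabla) (ξ := ξ) (X := v) hW hx hv
    have e2 := covDerivForm_field (nabla := nabla) (ξ := ξ) (X := e) hW hx hv
    have e3 := covDerivForm_field (nabla := nabla) (ξ := ξ) (X := v) hW hx he
    have e4 := covDerivForm_field (nabla := nabla) (ξ := ξ) (X := e) hW hx he
    rw [covDerivForm_self hξ, z.1] at e1
    rw [covDerivForm_skew hξ, h.deriv_v_e x hx, z.2] at e2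
    rw [h.deriv_v_e x hx, z'] at e3
    rw [covDerivForm_self hξ, z'] at e4
    refine ⟨?_, ?_, ?_, ?_⟩ <;> linarith
  set a : M → ℝ := fun x => ricci nabla x (covField nabla v v x) (e x) / (4 * ψ x)
  set p : M → ℝ := fun x => ricci nabla x (covField nabla e v x) (e x) / (4 * ψ x)
  set m : M → ℝ := fun x => ricci nabla x (covField nabla v e x) (e x) / (4 * ψ x)
  set q : M → ℝ := fun x => ricci nabla x (covField nabla e e x) (e x) / (4 * ψ x)
  have v_v : ∀ x ∈ W, covField nabla v v x = a x • v x := fun x hx => by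
    have := h.eq_combination hnabla hx (covField nabla v v x)
    rwa [(key x hx).1, zero_div, zero_smul, add_zero] at this
  have e_v : ∀ x ∈ W, covField nabla e v x = p x • v x + ψ x • e x := fun x hx => by
    have := h.eq_combination hnabla hx (covField nabla e v x)
    rwa [(key x hx).2.1, pow_two, mul_div_cancel_right₀ _ (h.psi_ne_zero x hx)] at this
  have v_e : ∀ x ∈ W, covField nabla v e x
      = m x • v x + ((dirDeriv v ψ x - ψ x ^ 2) / ψ x) • e x := fun x hx => by
    have := h.eq_combination hnabla hx (covField nabla v e x)
    rwa [(key x hx).2.2.1] at this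
  have e_e : ∀ x ∈ W, covField nabla e e x
      = q x • v x + (dirDeriv e ψ x / ψ x) • e x := fun x hx => by
    have := h.eq_combination hnabla hx (covField nabla e e x)
    rwa [(key x hx).2.2.2] at this
  have sq (X : Π x : M, TangentSpace (𝓡 2) x) : ∀ x ∈ W,
      dirDeriv X (fun x => covDerivForm nabla ξ x (v x) (e x)) x = 2 * ψ x * dirDeriv X ψ x :=
    fun x hx => by
    rw [dirDeriv_congr hW hx (g := ψ * ψ) fun y hy => (h.deriv_v_e y hy).trans (pow_two _),
      dirDeriv_mul (h.smooth_psi.mdiff hW hx) (h.smooth_psi.mdiff hW hx)]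
    ring
  have v_psi : ∀ x ∈ W, dirDeriv v ψ x = (a x - ψ x) * ψ x := fun x hx => by
    have hψ := h.psi_ne_zero x hx
    have := secondCovDeriv_eq hnabla hξ hW hx hv he hv
    rw [secondCovDeriv, sq v x hx, v_v x hx, v_e x hx, covDerivForm_smul_left,
      covDerivForm_add_right hξ, covDerivForm_smul_right hξ, covDerivForm_smul_right hξ,
      covDerivForm_self hξ, h.deriv_v_e x hx, h.eval_v x hx] at this
    field_simp at this
    have h2 : ψ x * (dirDeriv v ψ x - (a x - ψ x) * ψ x) = 0 := by linear_combination this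
    exact sub_eq_zero.1 ((mul_eq_zero.1 h2).resolve_left hψ)
  have e_psi : ∀ x ∈ W, dirDeriv e ψ x = (p x - 4) * ψ x := fun x hx => by
    have hψ := h.psi_ne_zero x hx
    have := secondCovDeriv_eq hnabla hξ hW hx hv he he
    rw [secondCovDeriv, sq e x hx, e_v x hx, e_e x hx, covDerivForm_add_left,
      covDerivForm_smul_left, covDerivForm_smul_left,
      covDerivForm_add_right hξ, covDerivForm_smul_right hξ, covDerivForm_smul_right hξ,
      covDerivForm_self hξ, covDerivForm_self hξ, h.deriv_v_e x hx, h.eval_e x hx,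
      h.ricci_v_e x hx] at this
    field_simp at this
    have h2 : ψ x * (dirDeriv e ψ x - (p x - 4) * ψ x) = 0 := by linear_combination this
    exact sub_eq_zero.1 ((mul_eq_zero.1 h2).resolve_left hψ)
  refine ⟨a, p, m, q, smooth (hv.covField hs hW hv), smooth (he.covField hs hW hv),
    smooth (hv.covField hs hW he), smooth (he.covField hs hW he), v_v, e_v, fun x hx => ?_,
    fun x hx => ?_, v_psi, e_psi⟩
  · have hψ := h.psi_ne_zero x hx
    have e : ((a x - ψ x) * ψ x - ψ x ^ 2) / ψ x = a x - 2 * ψ x := by field_simp; ring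
    rw [v_e x hx, v_psi x hx, e]
  · rw [e_e x hx, e_psi x hx, mul_div_cancel_right₀ _ (h.psi_ne_zero x hx)]

theorem HasStructureEqs.mlieBracket_eq [T2Space M] (H : HasStructureEqs nabla W v e ψ a p m q)
    (h : IsKillingFrame nabla ξ W v e ψ) (hnabla : IsRSTS nabla) (hx : x ∈ W) :
    mlieBracket (𝓡 2) v e x = (m x - p x) • v x + (a x - 3 * ψ x) • e x := by
  rw [← hnabla.covField_sub h.isOpen hx h.smooth_v h.smooth_e, H.v_e x hx, H.e_v x hx]
  module

/-- The `v`-component of `R(v, e) v = 4ψ v`. -/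
theorem HasStructureEqs.curvature_v [T2Space M] (H : HasStructureEqs nabla W v e ψ a p m q)
    (h : IsKillingFrame nabla ξ W v e ψ) (hnabla : IsRSTS nabla) (hx : x ∈ W) :
    dirDeriv e a x - dirDeriv v p x - ψ x * m x + (m x - p x) * a x + (a x - 3 * ψ x) * p x
      = 4 * ψ x := by
  have hW := h.isOpen
  have hv := h.smooth_v
  have he := h.smooth_e
  have hs := hnabla.smooth
  have c := hnabla.curvatureField_eq hW hx hv he hv
  simp only [curvatureField_eq_covField, Pi.add_apply, Pi.sub_apply] at c
  rw [covField_congr hW hx (hv.covField hs hW hv) (Y' := a • v) H.v_v,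
    covField_congr hW hx (he.covField hs hW hv) (Y' := p • v + ψ • e) H.e_v,
    covField_smul hW hx H.smooth_a hv,
    covField_add hW hx (hv.smul H.smooth_p) (he.smul h.smooth_psi),
    covField_smul hW hx H.smooth_p hv, covField_smul hW hx h.smooth_psi he,
    H.v_v x hx, H.e_v x hx, H.v_e x hx, h.ricci_v_e x hx] at c
  have b : covField nabla (mlieBracket (𝓡 2) v e) v x
      = (m x - p x) • covField nabla v v x + (a x - 3 * ψ x) • covField nabla e v x := by
    simp only [covField]
    rw [H.mlieBracket_eq h hnabla hx, map_add, map_smul, map_smul]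
  rw [b, H.v_v x hx, H.e_v x hx] at c
  refine (h.eq_of_combination_eq hnabla hx (s' := 4 * ψ x) (t' := 0)
    (t := a x * ψ x - dirDeriv v ψ x - ψ x * (a x - 2 * ψ x) + (a x - 3 * ψ x) * ψ x) ?_).1
  rw [zero_smul, add_zero, ← c]
  module

/-- The action of `[v, e]` on `ψ`, computed from the bracket and as a commutator, involves `d_e a -
d_v p` in the same combination as the curvature equation. Eliminating it also removes `m` and `p`,
leaving `ψ (a - 5ψ) = 0`. -/
theorem HasStructureEqs.a_eq [T2Space M] (H : HasStructureEqs nabla W v e ψ a p m q)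
    (h : IsKillingFrame nabla ξ W v e ψ) (hnabla : IsRSTS nabla) (hx : x ∈ W) :
    a x = 5 * ψ x := by
  have hW := h.isOpen
  have hv := h.smooth_v
  have he := h.smooth_e
  have hψ := h.psi_ne_zero x hx
  have c1 := H.curvature_v h hnabla hx
  have c2 := dirDeriv_mlieBracket hW hx hv he h.smooth_psi
  have four : SmoothFun W (fun _ : M => (4 : ℝ)) := contMDiffOn_const
  have pm := h.smooth_psi.mdiff hW hx
  have s1 : SmoothFun W (a - ψ) := H.smooth_a.sub h.smooth_psi
  have s2 : SmoothFun W (p - fun _ => 4) := H.smooth_p.sub four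
  rw [dirDeriv_congr hW hx (g := (a - ψ) * ψ) H.v_psi, dirDeriv_congr hW hx (g := (p - fun _ : M => (4 : ℝ)) * ψ) H.e_psi,
    dirDeriv_mul (s1.mdiff hW hx) pm,
    dirDeriv_mul (s2.mdiff hW hx) pm,
    dirDeriv_sub (H.smooth_a.mdiff hW hx) pm, dirDeriv_sub (H.smooth_p.mdiff hW hx)
    (four.mdiff hW hx), dirDeriv_const] at c2
  have b : dirDeriv (mlieBracket (𝓡 2) v e) ψ x
      = (m x - p x) * dirDeriv v ψ x + (a x - 3 * ψ x) * dirDeriv e ψ x := by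
    simp only [dirDeriv]
    rw [H.mlieBracket_eq h hnabla hx, map_add, map_smul, map_smul]
    rfl
  rw [b, H.v_psi x hx, H.e_psi x hx] at c2
  simp only [Pi.sub_apply] at c2
  have h2 : ψ x * (a x - 5 * ψ x) = 0 := by
    linear_combination (-1/4) * c2 + ψ x / 4 * c1
  exact sub_eq_zero.1 ((mul_eq_zero.1 h2).resolve_left hψ)

theorem HasStructureEqs.curvature_e [T2Space M] (H : HasStructureEqs nabla W v e ψ a p m q)
    (h : IsKillingFrame nabla ξ W v e ψ) (hnabla : IsRSTS nabla)
    (hp : ∀ x ∈ W, p x = 0) (hm : ∀ x ∈ W, m x = 6) (hx : x ∈ W) :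
    dirDeriv v q x = 60 := by
  have hW := h.isOpen
  have hv := h.smooth_v
  have he := h.smooth_e
  have hs := hnabla.smooth
  have six : SmoothFun W (fun _ : M => (6 : ℝ)) := contMDiffOn_const
  have four : SmoothFun W (fun _ : M => (-4 : ℝ)) := contMDiffOn_const
  have three : SmoothFun W (fun x => 3 * ψ x) := contMDiffOn_const.mul h.smooth_psi
  have v_e : ∀ x ∈ W, covField nabla v e x = (6 : ℝ) • v x + (3 * ψ x) • e x := fun x hx => by
    rw [H.v_e x hx, hm x hx, H.a_eq h hnabla hx]
    module
  have e_e : ∀ x ∈ W, covField nabla e e x = q x • v x + (-4 : ℝ) • e x := fun x hx => by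
    rw [H.e_e x hx, hp x hx, zero_sub]
  have c := hnabla.curvatureField_eq hW hx hv he he
  simp only [curvatureField_eq_covField, Pi.add_apply, Pi.sub_apply] at c
  rw [covField_congr hW hx (hv.covField hs hW he)
      (Y' := (fun _ : M => (6 : ℝ)) • v + (fun x => 3 * ψ x) • e) v_e,
    covField_congr hW hx (he.covField hs hW he)
      (Y' := q • v + (fun _ : M => (-4 : ℝ)) • e) e_e,
    covField_add hW hx (hv.smul six) (he.smul three),
    covField_add hW hx (hv.smul H.smooth_q) (he.smul four),
    covField_smul hW hx six hv, covField_smul hW hx three he,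
    covField_smul hW hx H.smooth_q hv, covField_smul hW hx four he, dirDeriv_const, dirDeriv_const,
    H.v_v x hx, H.e_v x hx, v_e x hx, e_e x hx, h.ricci_v_e x hx] at c
  have b : covField nabla (mlieBracket (𝓡 2) v e) e x
      = (6 : ℝ) • covField nabla v e x + (2 * ψ x) • covField nabla e e x := by
    simp only [covField]
    rw [H.mlieBracket_eq h hnabla hx, map_add, map_smul, map_smul, hm x hx, hp x hx,
      H.a_eq h hnabla hx]
    module
  rw [b, v_e x hx, e_e x hx] at c
  simp only [hp x hx, H.a_eq h hnabla hx] at c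
  -- The `v`-component of `R(v, e) e = 4ψ e` is zero. The terms in `ψ q` cancel as `3 - 5 + 2 = 0`,
  -- and `60 = 24 + 36` comes from `4 ∇_v e` and the bracket term `6 ∇_v e`.
  have := (h.eq_of_combination_eq hnabla hx (s := 60 - dirDeriv v q x) (s' := 0) (t' := 4 * ψ x)
    (t := 6 * ψ x + dirDeriv e (fun x => 3 * ψ x) x + 3 * ψ x * (-4) - (-4) * (3 * ψ x)
      + 6 * (3 * ψ x) + 2 * ψ x * (-4)) ?_).1
  · linarith
  rw [zero_smul, zero_add, ← c]
  module

theorem IsKillingFrame.exists_quadruple [T2Space M] (h : IsKillingFrame nabla ξ W v e ψ)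
    (hnabla : IsRSTS nabla) (hξ : ξ ∈ killingKernel nabla) :
    ∃ (w : Π y : M, TangentSpace (𝓡 2) y) (χ : M → ℝ),
        IsQuadrupleOn W v w ψ χ ∧ IsGivenByOn nabla W v w ψ χ := by
  have hW := h.isOpen
  obtain ⟨a, p, m, q, H⟩ := h.exists_structureEqs hnabla hξ
  -- As `d_v ψ = 4ψ²`, adding `g v` to `e` changes `d_e ψ = (p - 4) ψ` by `4 g ψ²`; this `g` makes
  -- it `-4ψ`, that is, `p = 0`.
  set g : M → ℝ := fun x => -(p x) / (4 * ψ x) with hg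
  have sg : SmoothFun W g := by
    have h4 : SmoothFun W (fun x => 4 * ψ x) := contMDiffOn_const.mul h.smooth_psi
    exact H.smooth_p.neg.div₀ h4 fun x hx => mul_ne_zero four_ne_zero (h.psi_ne_zero x hx)
  set w : Π y : M, TangentSpace (𝓡 2) y := e + g • v with hw
  have wx (x : M) : w x = e x + g x • v x := rfl
  -- The frame conditions survive the change because `ξ(v) = 0` and both `ρ` and `∇ξ` are skew.
  have h' : IsKillingFrame nabla ξ W v w ψ :=
    { isOpen := hW
      smooth_v := h.smooth_v
      smooth_e := h.smooth_e.add (h.smooth_v.smul sg)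
      smooth_psi := h.smooth_psi
      psi_ne_zero := h.psi_ne_zero
      eval_v := h.eval_v
      eval_e := fun x hx => by simp [wx, h.eval_e x hx, h.eval_v x hx]
      ricci_v_e := fun x hx => by
        rw [wx, hnabla.ricci_add_right, hnabla.ricci_smul_right, hnabla.ricci_self,
          h.ricci_v_e x hx]
        ring
      deriv_v_e := fun x hx => by
        rw [wx, covDerivForm_add_right hξ, covDerivForm_smul_right hξ, covDerivForm_self hξ,
          h.deriv_v_e x hx]
        ring }
  have w_psi : ∀ x ∈ W, dirDeriv w ψ x = -4 * ψ x := fun x hx => by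
    have hψ := h.psi_ne_zero x hx
    rw [hw, dirDeriv_add_left, dirDeriv_smul_left, H.v_psi x hx, H.e_psi x hx]
    simp only [H.a_eq h hnabla hx, hg]
    field_simp
    ring
  obtain ⟨a', p', m', q', H'⟩ := h'.exists_structureEqs hnabla hξ
  have ha : ∀ x ∈ W, a' x = 5 * ψ x := fun x hx => H'.a_eq h' hnabla hx
  have hp : ∀ x ∈ W, p' x = 0 := fun x hx => by
    have h1 := H'.e_psi x hx
    rw [w_psi x hx] at h1
    have := mul_right_cancel₀ (h.psi_ne_zero x hx) h1
    linarith
  -- With `p' = 0`, `a' = 5ψ` and `d_w ψ = -4ψ`, the curvature equation reads `-20ψ + 4ψ m' = 4ψ`.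
  have hm : ∀ x ∈ W, m' x = 6 := fun x hx => by
    have hψ := h.psi_ne_zero x hx
    have c := H'.curvature_v h' hnabla hx
    rw [dirDeriv_congr hW hx (f := p') (g := fun _ => 0) fun y hy => hp y hy, dirDeriv_const,
      dirDeriv_congr hW hx (f := a') (g := (fun _ => 5) * ψ) fun y hy => ha y hy,
      dirDeriv_mul mdifferentiableAt_const (h.smooth_psi.mdiff hW hx), dirDeriv_const,
      w_psi x hx, hp x hx, ha x hx] at c
    have h2 : ψ x * (m' x - 6) = 0 := by linear_combination c / 4
    exact sub_eq_zero.1 ((mul_eq_zero.1 h2).resolve_left hψ)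
  have hli : ∀ x ∈ W, ∀ s t : ℝ, s • v x + t • w x = 0 → s = 0 ∧ t = 0 := fun x hx s t hst =>
    h'.eq_of_combination_eq hnabla hx (by simpa using hst)
  refine ⟨w, fun x => q' x / 15, ?_, ?_⟩
  · refine
      { smooth_v := h.smooth_v
        smooth_w := h'.smooth_e
        smooth_psi := h.smooth_psi
        smooth_chi := H'.smooth_q.div₀ contMDiffOn_const fun _ _ => by norm_num
        linearIndependent := fun x hx => LinearIndependent.pair_iff.2 (hli x hx)
        span_eq_top := fun x hx => ?_
        bracket := fun x hx => ?_
        deriv_psi_v := fun x hx => ?_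
        deriv_psi_w := w_psi
        deriv_chi_v := fun x hx => ?_
        psi_ne_zero := h.psi_ne_zero }
    · refine eq_top_iff.2 fun u _ => ?_
      rw [h'.eq_combination hnabla hx u]
      exact Submodule.mem_span_pair.2 ⟨_, _, rfl⟩
    · rw [H'.mlieBracket_eq h' hnabla hx, ha x hx, hp x hx, hm x hx]
      module
    · have := H'.v_psi x hx
      simp only [ha x hx] at this
      exact this.trans (by ring)
    · have c := H'.curvature_e h' hnabla hp hm hx
      change dirDeriv v (fun x => q' x / 15) x = 4
      have e : (fun x => q' x / 15) = (fun _ => 1 / 15) * q' := by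
        funext y
        simp only [Pi.mul_apply]
        ring
      rw [e, dirDeriv_mul mdifferentiableAt_const (H'.smooth_q.mdiff hW hx), dirDeriv_const, c]
      norm_num
  · refine
      { nabla_v_v := fun x hx => ?_
        nabla_w_v := fun x hx => ?_
        nabla_v_w := fun x hx => ?_
        nabla_w_w := fun x hx => ?_ }
    · exact (H'.v_v x hx).trans (by rw [ha x hx])
    · exact (H'.e_v x hx).trans (by rw [hp x hx, zero_smul, zero_add])
    · refine (H'.v_e x hx).trans ?_
      rw [ha x hx, hm x hx]
      module
    · refine (H'.e_e x hx).trans ?_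
      rw [hp x hx]
      module

end Frame

/-! ### Unique continuation for Killing forms -/

section UniqueContinuation

variable {M : Type*} [TopologicalSpace M] [ChartedSpace (EuclideanSpace ℝ (Fin 2)) M]
  [IsManifold (𝓡 2) ∞ M]

variable {W : Set M} {X Y Z : Π x : M, TangentSpace (𝓡 2) x} {g : M → ℝ} {x₀ x : M}
  {nabla : Connection M} {ξ : OneForm M}

/-- The set where a 1-form does not vanish. -/
def formSupport (ξ : OneForm M) : Set M := {x | ∃ u, evalAt ξ x u ≠ 0}

/-- The set where the covariant derivative of a 1-form does not vanish. -/
def derivSupport (nabla : Connection M) (ξ : OneForm M) : Set M :=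
  {x | ∃ u v, covDerivForm nabla ξ x u v ≠ 0}

theorem SmoothFun.eventually_ne (hg : SmoothFun W g) (hW : IsOpen W) (hx : x ∈ W) (h0 : g x ≠ 0) :
    ∀ᶠ y in 𝓝 x, g y ≠ 0 :=
  (hg.continuousOn.continuousAt (hW.mem_nhds hx)).eventually_ne h0

theorem isOpen_formSupport (ξ : OneForm M) : IsOpen (formSupport ξ) := by
  refine isOpen_iff_mem_nhds.2 fun x ⟨u, hu⟩ => ?_
  have h := (smoothFun_pairing ξ (smoothField_extend u)).eventually_ne (isOpen_chartDomain x)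
    (mem_chartDomain x) (by simpa only [pairing, extend_apply_self] using hu)
  exact h.mono fun y hy => ⟨_, hy⟩

theorem isOpen_derivSupport [T2Space M]
    (hnabla : CovariantDerivative.ContMDiffCovariantDerivative nabla ∞) (ξ : OneForm M) :
    IsOpen (derivSupport nabla ξ) := by
  refine isOpen_iff_mem_nhds.2 fun x ⟨u, v, hu⟩ => ?_
  have h := (smoothFun_covDerivForm hnabla ξ (isOpen_chartDomain x) (smoothField_extend u)
    (smoothField_extend v)).eventually_ne (isOpen_chartDomain x)
    (mem_chartDomain x) (by simpa only [extend_apply_self] using hu)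
  exact h.mono fun y hy => ⟨_, _, hy⟩

theorem SmoothFun.exists_eventually_abs_le (hg : SmoothFun W g) (hW : IsOpen W) (hx : x ∈ W) :
    ∃ C, 0 ≤ C ∧ ∀ᶠ y in 𝓝 x, |g y| ≤ C := by
  have h : Filter.Tendsto (fun y => |g y|) (𝓝 x) (𝓝 |g x|) :=
    (hg.continuousOn.continuousAt (hW.mem_nhds hx)).abs
  exact ⟨|g x| + 1, by positivity, h.eventually_le_const (by linarith)⟩

/-- The size of `(ξ, ∇ξ)` in the frame `chartFrame x₀`. -/
def jetSize (nabla : Connection M) (ξ : OneForm M) (x₀ x : M) : ℝ :=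
  |pairing ξ (chartFrame x₀ 0) x| + |pairing ξ (chartFrame x₀ 1) x|
    + |covDerivForm nabla ξ x (chartFrame x₀ 0 x) (chartFrame x₀ 1 x)|

/-- The sum of the squares of the components of `(ξ, ∇ξ)` in the frame `chartFrame x₀`. -/
def jetEnergy (nabla : Connection M) (ξ : OneForm M) (x₀ : M) : M → ℝ :=
  pairing ξ (chartFrame x₀ 0) * pairing ξ (chartFrame x₀ 0)
    + pairing ξ (chartFrame x₀ 1) * pairing ξ (chartFrame x₀ 1)
    + (fun x => covDerivForm nabla ξ x (chartFrame x₀ 0 x) (chartFrame x₀ 1 x)) *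
      (fun x => covDerivForm nabla ξ x (chartFrame x₀ 0 x) (chartFrame x₀ 1 x))

theorem covDerivForm_eq_chartCoeff (hξ : ξ ∈ killingKernel nabla) (hx : x ∈ chartDomain x₀)
    (u v : TangentSpace (𝓡 2) x) :
    covDerivForm nabla ξ x u v
      = (chartCoeff x₀ 0 x u * chartCoeff x₀ 1 x v - chartCoeff x₀ 1 x u * chartCoeff x₀ 0 x v)
        * covDerivForm nabla ξ x (chartFrame x₀ 0 x) (chartFrame x₀ 1 x) := by
  conv_lhs => rw [eq_chartCoeff_smul hx u, eq_chartCoeff_smul hx v]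
  simp only [covDerivForm_add_left, covDerivForm_smul_left, covDerivForm_add_right hξ,
    covDerivForm_smul_right hξ, covDerivForm_self hξ,
    covDerivForm_skew hξ (chartFrame x₀ 1 x) (chartFrame x₀ 0 x)]
  ring

theorem evalAt_eq_chartCoeff (hx : x ∈ chartDomain x₀) (u : TangentSpace (𝓡 2) x) :
    evalAt ξ x u = chartCoeff x₀ 0 x u * pairing ξ (chartFrame x₀ 0) x
      + chartCoeff x₀ 1 x u * pairing ξ (chartFrame x₀ 1) x := by
  conv_lhs => rw [eq_chartCoeff_smul hx u]
  rw [map_add, map_smul, map_smul]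
  rfl

theorem jetEnergy_eq_zero_iff (hξ : ξ ∈ killingKernel nabla) (hx : x ∈ chartDomain x₀) :
    jetEnergy nabla ξ x₀ x = 0 ↔ x ∉ formSupport ξ ∪ derivSupport nabla ξ := by
  simp only [Set.mem_union, formSupport, derivSupport, Set.mem_ofPred_eq, not_or, not_exists,
    not_not]
  constructor
  · intro h
    simp only [jetEnergy, Pi.add_apply, Pi.mul_apply] at h
    have h0 : pairing ξ (chartFrame x₀ 0) x = 0 := by nlinarith
    have h1 : pairing ξ (chartFrame x₀ 1) x = 0 := by nlinarith
    have h2 : covDerivForm nabla ξ x (chartFrame x₀ 0 x) (chartFrame x₀ 1 x) = 0 := by nlinarith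
    refine ⟨fun u => ?_, fun u v => ?_⟩
    · rw [evalAt_eq_chartCoeff hx, h0, h1]; ring
    · rw [covDerivForm_eq_chartCoeff hξ hx, h2]; ring
  · rintro ⟨h1, h2⟩
    simp only [jetEnergy, Pi.add_apply, Pi.mul_apply, pairing, h1, h2]
    ring

/-- Frame coefficients of a smooth field are bounded near `x₀`, so linear expressions in the 1-jet
are dominated by `jetSize`. -/
theorem exists_eventually_abs_pairing_le (hX : SmoothField (chartDomain x₀) X) :
    ∃ C, 0 ≤ C ∧ ∀ᶠ y in 𝓝 x₀, |evalAt ξ y (X y)| ≤ C * jetSize nabla ξ x₀ y := by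
  have hD := isOpen_chartDomain x₀
  have hx := mem_chartDomain x₀
  obtain ⟨A, hA, hA'⟩ := (smoothFun_chartCoeff hD subset_rfl hX 0).exists_eventually_abs_le hD hx
  obtain ⟨B, hB, hB'⟩ := (smoothFun_chartCoeff hD subset_rfl hX 1).exists_eventually_abs_le hD hx
  refine ⟨A + B, by positivity, ?_⟩
  filter_upwards [hA', hB', hD.mem_nhds hx] with y h1 h2 h3
  rw [evalAt_eq_chartCoeff h3, jetSize]
  refine (abs_add_le _ _).trans ?_
  rw [abs_mul, abs_mul]
  have e0 := abs_nonneg (pairing ξ (chartFrame x₀ 0) y)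
  have e1 := abs_nonneg (pairing ξ (chartFrame x₀ 1) y)
  have e2 := abs_nonneg (covDerivForm nabla ξ y (chartFrame x₀ 0 y) (chartFrame x₀ 1 y))
  have k1 := mul_le_mul_of_nonneg_right h1 e0
  have k2 := mul_le_mul_of_nonneg_right h2 e1
  nlinarith [mul_nonneg hA e1, mul_nonneg hA e2, mul_nonneg hB e0, mul_nonneg hB e2]

theorem exists_eventually_abs_covDerivForm_le (hξ : ξ ∈ killingKernel nabla)
    (hX : SmoothField (chartDomain x₀) X) (hY : SmoothField (chartDomain x₀) Y) :
    ∃ C, 0 ≤ C ∧ ∀ᶠ y in 𝓝 x₀, |covDerivForm nabla ξ y (X y) (Y y)| ≤ C * jetSize nabla ξ x₀ y := by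
  have hD := isOpen_chartDomain x₀
  have hx := mem_chartDomain x₀
  have c {V : Π x : M, TangentSpace (𝓡 2) x} (hV : SmoothField (chartDomain x₀) V) (i) :=
    smoothFun_chartCoeff hD subset_rfl hV i
  have s : SmoothFun (chartDomain x₀) (fun x => chartCoeff x₀ 0 x (X x) * chartCoeff x₀ 1 x (Y x)
      - chartCoeff x₀ 1 x (X x) * chartCoeff x₀ 0 x (Y x)) :=
    ((c hX 0).mul (c hY 1)).sub ((c hX 1).mul (c hY 0))
  obtain ⟨A, hA, hA'⟩ := s.exists_eventually_abs_le hD hx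
  refine ⟨A, hA, ?_⟩
  filter_upwards [hA', hD.mem_nhds hx] with y h1 h3
  rw [covDerivForm_eq_chartCoeff hξ h3, jetSize, abs_mul]
  have e0 := abs_nonneg (pairing ξ (chartFrame x₀ 0) y)
  have e1 := abs_nonneg (pairing ξ (chartFrame x₀ 1) y)
  have e2 := abs_nonneg (covDerivForm nabla ξ y (chartFrame x₀ 0 y) (chartFrame x₀ 1 y))
  have k1 := mul_le_mul_of_nonneg_right h1 e2
  nlinarith [mul_nonneg hA e1, mul_nonneg hA e0]

theorem smoothFun_jetEnergy [T2Space M]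
    (hnabla : CovariantDerivative.ContMDiffCovariantDerivative nabla ∞) (ξ : OneForm M) (x₀ : M) :
    SmoothFun (chartDomain x₀) (jetEnergy nabla ξ x₀) := by
  have h0 := smoothFun_pairing ξ (smoothField_chartFrame x₀ 0)
  have h1 := smoothFun_pairing ξ (smoothField_chartFrame x₀ 1)
  have h2 := smoothFun_covDerivForm hnabla ξ (isOpen_chartDomain x₀) (smoothField_chartFrame x₀ 0)
    (smoothField_chartFrame x₀ 1)
  exact ((h0.mul h0).add (h1.mul h1)).add (h2.mul h2)

/-- The doubled products are what differentiating squares produces. The constant is `6 = 2 · 3`, the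
3 from Cauchy–Schwarz for three summands. -/
theorem abs_add_mul_le {s t h s' t' h' A : ℝ} (hA : 0 ≤ A)
    (hs : |s'| ≤ A * (|s| + |t| + |h|)) (ht : |t'| ≤ A * (|s| + |t| + |h|))
    (hh : |h'| ≤ A * (|s| + |t| + |h|)) :
    |s * s' + s * s' + (t * t' + t * t') + (h * h' + h * h')|
      ≤ 6 * A * (s * s + t * t + h * h) := by
  have e0 := abs_nonneg s
  have e1 := abs_nonneg t
  have e2 := abs_nonneg h
  have k {a b : ℝ} (hb : |b| ≤ A * (|s| + |t| + |h|)) :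
      |a * b| ≤ |a| * (A * (|s| + |t| + |h|)) := by
    rw [abs_mul]; exact mul_le_mul_of_nonneg_left hb (abs_nonneg a)
  have k1 := k (a := s) hs
  have k2 := k (a := t) ht
  have k3 := k (a := h) hh
  have b : |s * s' + s * s' + (t * t' + t * t') + (h * h' + h * h')|
      ≤ 2 * A * (|s| + |t| + |h|) ^ 2 := by
    have : s * s' + s * s' + (t * t' + t * t') + (h * h' + h * h')
      = 2 * (s * s' + t * t' + h * h') := by ring
    rw [this, abs_mul, abs_two]
    have := abs_add_three (s * s') (t * t') (h * h')
    nlinarith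
  have q : (|s| + |t| + |h|) ^ 2 ≤ 3 * (s * s + t * t + h * h) := by
    rw [← abs_mul_abs_self s, ← abs_mul_abs_self t, ← abs_mul_abs_self h]
    nlinarith [sq_nonneg (|s| - |t|), sq_nonneg (|s| - |h|), sq_nonneg (|t| - |h|)]
  nlinarith

/-- The first derivatives of the components of `(ξ, ∇ξ)` are linear in these components with locally
bounded coefficients: for `ξ` by definition of `∇ξ`, for `∇ξ` by the prolongation equation. -/
theorem exists_eventually_abs_dirDeriv_jetEnergy_le [T2Space M] (hnabla : IsRSTS nabla)
    (hξ : ξ ∈ killingKernel nabla) (x₀ : M) (i : Fin 2) :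
    ∃ C, 0 ≤ C ∧ ∀ᶠ y in 𝓝 x₀,
      |dirDeriv (chartFrame x₀ i) (jetEnergy nabla ξ x₀) y| ≤ C * jetEnergy nabla ξ x₀ y := by
  have hD := isOpen_chartDomain x₀
  have hx := mem_chartDomain x₀
  have hs := hnabla.smooth
  have hE (j) := smoothField_chartFrame x₀ j
  have hN (j) : SmoothField (chartDomain x₀) (covField nabla (chartFrame x₀ i) (chartFrame x₀ j)) :=
    (hE i).covField hs hD (hE j)
  have first (j) : ∃ C, 0 ≤ C ∧ ∀ᶠ y in 𝓝 x₀,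
      |dirDeriv (chartFrame x₀ i) (pairing ξ (chartFrame x₀ j)) y| ≤ C * jetSize nabla ξ x₀ y := by
    obtain ⟨A, hA, hA'⟩ := exists_eventually_abs_covDerivForm_le hξ (hE i) (hE j)
    obtain ⟨B, hB, hB'⟩ := exists_eventually_abs_pairing_le (nabla := nabla) (ξ := ξ) (hN j)
    refine ⟨A + B, by positivity, ?_⟩
    filter_upwards [hA', hB', hD.mem_nhds hx] with y h1 h2 h3
    have e := covDerivForm_field (nabla := nabla) (ξ := ξ) (X := chartFrame x₀ i) hD h3 (hE j)
    rw [show dirDeriv (chartFrame x₀ i) (pairing ξ (chartFrame x₀ j)) y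
        = covDerivForm nabla ξ y (chartFrame x₀ i y) (chartFrame x₀ j y)
          + evalAt ξ y (covField nabla (chartFrame x₀ i) (chartFrame x₀ j) y) by linarith, add_mul]
    exact (abs_add_le _ _).trans (add_le_add h1 h2)
  have second : ∃ C, 0 ≤ C ∧ ∀ᶠ y in 𝓝 x₀,
      |dirDeriv (chartFrame x₀ i) (fun x => covDerivForm nabla ξ x (chartFrame x₀ 0 x)
        (chartFrame x₀ 1 x)) y| ≤ C * jetSize nabla ξ x₀ y := by
    obtain ⟨A, hA, hA'⟩ := exists_eventually_abs_covDerivForm_le hξ (hN 0) (hE 1)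
    obtain ⟨B, hB, hB'⟩ := exists_eventually_abs_covDerivForm_le hξ (hE 0) (hN 1)
    obtain ⟨R, hR, hR'⟩ :=
      (hnabla.smoothFun_ricci hD (hE 0) (hE 1)).exists_eventually_abs_le hD hx
    obtain ⟨C, hC, hC'⟩ := exists_eventually_abs_pairing_le (nabla := nabla) (ξ := ξ) (hE i)
    refine ⟨A + B + R * C, by positivity, ?_⟩
    filter_upwards [hA', hB', hR', hC', hD.mem_nhds hx] with y h1 h2 h4 h5 h3
    have e := secondCovDeriv_eq hnabla hξ hD h3 (hE 0) (hE 1) (hE i)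
    rw [secondCovDeriv] at e
    have k := mul_le_mul h4 h5 (abs_nonneg _) hR
    rw [← abs_mul] at k
    rw [show dirDeriv (chartFrame x₀ i) (fun x => covDerivForm nabla ξ x (chartFrame x₀ 0 x)
        (chartFrame x₀ 1 x)) y = covDerivForm nabla ξ y (covField nabla (chartFrame x₀ i)
          (chartFrame x₀ 0) y) (chartFrame x₀ 1 y) + covDerivForm nabla ξ y (chartFrame x₀ 0 y)
          (covField nabla (chartFrame x₀ i) (chartFrame x₀ 1) y)
        + -(ricci nabla y (chartFrame x₀ 0 y) (chartFrame x₀ 1 y)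
          * evalAt ξ y (chartFrame x₀ i y)) by linarith]
    refine (abs_add_three _ _ _).trans ?_
    rw [abs_neg]
    nlinarith
  obtain ⟨A, hA, hA'⟩ := first 0
  obtain ⟨B, hB, hB'⟩ := first 1
  obtain ⟨C, hC, hC'⟩ := second
  refine ⟨6 * (A + B + C), by positivity, ?_⟩
  filter_upwards [hA', hB', hC', hD.mem_nhds hx] with y h0 h1 h2 h3
  have S0 : 0 ≤ jetSize nabla ξ x₀ y := by unfold jetSize; positivity
  have m0 := (smoothFun_pairing ξ (hE 0)).mdiff hD h3
  have m1 := (smoothFun_pairing ξ (hE 1)).mdiff hD h3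
  have m2 := (smoothFun_covDerivForm hs ξ hD (hE 0) (hE 1)).mdiff hD h3
  rw [jetEnergy, dirDeriv_add ((m0.mul m0).add (m1.mul m1)) (m2.mul m2),
    dirDeriv_add (m0.mul m0) (m1.mul m1), dirDeriv_mul m0 m0, dirDeriv_mul m1 m1,
    dirDeriv_mul m2 m2]
  exact abs_add_mul_le (by positivity) (h0.trans (by unfold jetSize at *; nlinarith))
    (h1.trans (by unfold jetSize at *; nlinarith)) (h2.trans (by unfold jetSize at *; nlinarith))

/-- Grönwall's inequality along the segment from `y₀` to `y`. -/
theorem eq_zero_of_abs_fderiv_le {E : Type*} [NormedAddCommGroup E] [NormedSpace ℝ E] {G : E → ℝ}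
    {y₀ : E} {r K : ℝ} (hG : ∀ y ∈ Metric.ball y₀ r, DifferentiableAt ℝ G y)
    (hK : ∀ y ∈ Metric.ball y₀ r, ∀ w, |fderiv ℝ G y w| ≤ K * ‖w‖ * |G y|) (h0 : G y₀ = 0) :
    ∀ y ∈ Metric.ball y₀ r, G y = 0 := by
  intro y hy
  have hr : 0 < r := (dist_nonneg).trans_lt hy
  have mem : ∀ t ∈ Set.Icc (0 : ℝ) 1, y₀ + t • (y - y₀) ∈ Metric.ball y₀ r := fun t ht => by
    have := (convex_ball y₀ r).add_smul_sub_mem (Metric.mem_ball_self hr) hy ht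
    exact this
  have hd : ∀ t ∈ Set.Icc (0 : ℝ) 1, HasDerivAt (fun t : ℝ => G (y₀ + t • (y - y₀)))
      (fderiv ℝ G (y₀ + t • (y - y₀)) (y - y₀)) t := fun t ht => by
    have h1 : HasDerivAt (fun t : ℝ => y₀ + t • (y - y₀)) (y - y₀) t := by
      simpa using ((hasDerivAt_id t).smul_const (y - y₀)).const_add y₀
    exact (hG _ (mem t ht)).hasFDerivAt.comp_hasDerivAt t h1
  have := eq_zero_of_abs_deriv_le_mul_abs_self_of_eq_zero_right
    (f := fun t : ℝ => G (y₀ + t • (y - y₀))) (K := K * ‖y - y₀‖) (a := 0) (b := 1)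
    (fun t ht => (hd t ht).continuousAt.continuousWithinAt)
    (fun t ht => (hd t (Set.Ico_subset_Icc_self ht)).hasDerivWithinAt) (by simpa using h0)
    (fun t ht => hK _ (mem t (Set.Ico_subset_Icc_self ht)) _) 1 (by simp)
  simpa using this

theorem fderiv_comp_extChartAt_symm (hg : MDifferentiableAt (𝓡 2) 𝓘(ℝ, ℝ) g x)
    (hx : x ∈ chartDomain x₀) (i : Fin 2) :
    fderiv ℝ (g ∘ (extChartAt (𝓡 2) x₀).symm) (extChartAt (𝓡 2) x₀ x)
      (EuclideanSpace.basisFun (Fin 2) ℝ i) = dirDeriv (chartFrame x₀ i) g x := by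
  have hs := TangentBundle.symmL_trivializationAt (I := 𝓡 2) (𝕜 := ℝ) hx
  have ht : extChartAt (𝓡 2) x₀ x ∈ (extChartAt (𝓡 2) x₀).target :=
    (extChartAt (𝓡 2) x₀).map_source (by rwa [extChartAt_source])
  have hl : (extChartAt (𝓡 2) x₀).symm (extChartAt (𝓡 2) x₀ x) = x :=
    (extChartAt (𝓡 2) x₀).left_inv (by rwa [extChartAt_source])
  have hd := mdifferentiableWithinAt_extChartAt_symm (I := 𝓡 2) ht
  have hr : Set.range (𝓡 2) = Set.univ := by simp
  rw [hr, mdifferentiableWithinAt_univ] at hd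
  rw [hr, mfderivWithin_univ] at hs
  have hc := mfderiv_comp_of_eq (I := 𝓘(ℝ, EuclideanSpace ℝ (Fin 2))) hg hd hl
  have he : chartFrame x₀ i x = (trivializationAt (EuclideanSpace ℝ (Fin 2))
      (TangentSpace (𝓡 2) : M → Type _) x₀).symmL ℝ x (EuclideanSpace.basisFun (Fin 2) ℝ i) := by
    rw [chartFrame, Trivialization.localFrame_apply_of_mem_baseSet _ _ hx]
    change (trivializationAt (EuclideanSpace ℝ (Fin 2)) (TangentSpace (𝓡 2) : M → Type _) x₀).symm x
      ((EuclideanSpace.basisFun (Fin 2) ℝ).toBasis i) = _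
    rw [OrthonormalBasis.coe_toBasis]
    exact (Trivialization.symmL_apply (trivializationAt (EuclideanSpace ℝ (Fin 2))
      (TangentSpace (𝓡 2) : M → Type _) x₀) hx _).symm
  rw [← mfderiv_eq_fderiv, dirDeriv, mvfderiv, he, hs]
  -- The derivatives at `x'` and `x` have different types; both are viewed on the model space, where
  -- the equality of points can be substituted.
  have key : ∀ x', x' = x → (mfderiv (𝓡 2) 𝓘(ℝ, ℝ) g x' : EuclideanSpace ℝ (Fin 2) →L[ℝ] ℝ)
      = mfderiv (𝓡 2) 𝓘(ℝ, ℝ) g x := by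
    rintro _ rfl
    rfl
  exact (DFunLike.congr_fun hc _).trans (DFunLike.congr_fun
    (key ((extChartAt (𝓡 2) x₀).symm (extChartAt (𝓡 2) x₀ x)) hl) _)

/-- Read in a chart, the energy satisfies `|dG| ≤ K |G|` on a ball, so a zero at the centre
propagates to the whole ball. -/
theorem isOpen_jet_zero [T2Space M] (hnabla : IsRSTS nabla) (hξ : ξ ∈ killingKernel nabla) :
    IsOpen (formSupport ξ ∪ derivSupport nabla ξ)ᶜ := by
  refine isOpen_iff_mem_nhds.2 fun x₀ hx₀ => ?_
  have hD := isOpen_chartDomain x₀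
  have hx := mem_chartDomain x₀
  obtain ⟨A, hA, hA'⟩ := exists_eventually_abs_dirDeriv_jetEnergy_le hnabla hξ x₀ 0
  obtain ⟨B, hB, hB'⟩ := exists_eventually_abs_dirDeriv_jetEnergy_le hnabla hξ x₀ 1
  set φ := extChartAt (𝓡 2) x₀ with hφ
  set G := jetEnergy nabla ξ x₀ ∘ φ.symm
  have hev := (hA'.and hB').and (hD.mem_nhds hx)
  have ht : Filter.Tendsto φ.symm (𝓝 (φ x₀)) (𝓝 x₀) := by
    have := continuousAt_extChartAt_symm (I := 𝓡 2) x₀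
    rwa [ContinuousAt, extChartAt_to_inv] at this
  have hev' := (ht.eventually hev).and (extChartAt_target_mem_nhds (I := 𝓡 2) x₀)
  obtain ⟨r, hr, hball⟩ := Metric.eventually_nhds_iff_ball.1 hev'
  have G0 : G (φ x₀) = 0 := by
    simp only [G, Function.comp, hφ, extChartAt_to_inv]
    exact (jetEnergy_eq_zero_iff hξ hx).2 hx₀
  have hG := eq_zero_of_abs_fderiv_le (G := G) (y₀ := φ x₀) (r := r) (K := A + B) ?_ ?_ G0
  · have hcont := (continuousAt_extChartAt (I := 𝓡 2) x₀).eventually (Metric.ball_mem_nhds _ hr)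
    filter_upwards [hcont, hD.mem_nhds hx] with x h1 h2
    have := hG _ h1
    simp only [G, Function.comp] at this
    rw [φ.left_inv (by rwa [hφ, extChartAt_source])] at this
    exact (jetEnergy_eq_zero_iff hξ h2).1 this
  · intro y hy
    obtain ⟨⟨_, h3⟩, h4⟩ := hball y hy
    have hd := mdifferentiableWithinAt_extChartAt_symm (I := 𝓡 2) h4
    rw [show Set.range (𝓡 2) = Set.univ by simp, mdifferentiableWithinAt_univ] at hd
    exact (((smoothFun_jetEnergy hnabla.smooth ξ x₀).mdiff hD h3).comp y hd).differentiableAt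
  · intro y hy w
    obtain ⟨⟨⟨h1, h2⟩, h3⟩, h4⟩ := hball y hy
    have e (i) := fderiv_comp_extChartAt_symm
      ((smoothFun_jetEnergy hnabla.smooth ξ x₀).mdiff hD h3) h3 i
    rw [← hφ, φ.right_inv h4] at e
    have hw := (EuclideanSpace.basisFun (Fin 2) ℝ).sum_repr w
    simp only [EuclideanSpace.basisFun_repr, Fin.sum_univ_two] at hw
    conv_lhs => rw [← hw]
    rw [map_add, map_smul, map_smul, e, e, smul_eq_mul, smul_eq_mul]
    have n0 : |w 0| ≤ ‖w‖ := PiLp.norm_apply_le w 0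
    have n1 : |w 1| ≤ ‖w‖ := PiLp.norm_apply_le w 1
    have k0 := mul_le_mul n0 (h1.trans (mul_le_mul_of_nonneg_left (le_abs_self _) hA))
      (abs_nonneg _) (norm_nonneg w)
    have k1 := mul_le_mul n1 (h2.trans (mul_le_mul_of_nonneg_left (le_abs_self _) hB))
      (abs_nonneg _) (norm_nonneg w)
    rw [← abs_mul] at k0 k1
    refine (abs_add_le _ _).trans ((add_le_add k0 k1).trans (le_of_eq ?_))
    simp only [G, Function.comp]
    ring

/-- The zero set of the 1-jet is open and closed, and it is not all of `M` because `ξ ≠ 0`. -/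
theorem union_support_eq_univ [T2Space M] [ConnectedSpace M] (hnabla : IsRSTS nabla)
    (hξ : ξ ∈ killingKernel nabla) (hne : ξ ≠ 0) :
    formSupport ξ ∪ derivSupport nabla ξ = Set.univ := by
  have h : IsClopen (formSupport ξ ∪ derivSupport nabla ξ) :=
    ⟨isOpen_compl_iff.1 (isOpen_jet_zero hnabla hξ),
      (isOpen_formSupport ξ).union (isOpen_derivSupport hnabla.smooth ξ)⟩
  refine (isClopen_iff.1 h).resolve_left fun h0 => hne ?_
  ext x u
  by_contra hu
  have : x ∈ (∅ : Set M) := h0 ▸ Or.inl ⟨u, hu⟩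
  exact this

/-- If `ξ` vanishes on an open set, so does `∇ξ`, which contradicts the nonvanishing of the 1-jet.
-/
theorem dense_formSupport [T2Space M] [ConnectedSpace M] (hnabla : IsRSTS nabla)
    (hξ : ξ ∈ killingKernel nabla) (hne : ξ ≠ 0) : Dense (formSupport ξ) := by
  refine dense_iff_inter_open.2 fun V hV ⟨x, hx⟩ => ?_
  by_contra hemp
  have h0 : ∀ y ∈ V, ∀ u, evalAt ξ y u = 0 := fun y hy u => by
    by_contra hu
    exact hemp ⟨y, hy, u, hu⟩
  have h1 : x ∉ derivSupport nabla ξ := by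
    rintro ⟨u, v, huv⟩
    apply huv
    have hVD : IsOpen (V ∩ chartDomain x) := hV.inter (isOpen_chartDomain x)
    have e := covDerivForm_field (nabla := nabla) (ξ := ξ) (x := x)
      (X := extend (EuclideanSpace ℝ (Fin 2)) u)
      hVD ⟨hx, mem_chartDomain x⟩ ((smoothField_extend v).mono Set.inter_subset_right)
    rw [dirDeriv_congr (f := pairing ξ (extend (EuclideanSpace ℝ (Fin 2)) v))
      (g := fun _ => 0) hVD ⟨hx, mem_chartDomain x⟩ fun y hy => h0 y hy.1 _, dirDeriv_const,
      h0 x hx, sub_zero, extend_apply_self, extend_apply_self] at e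
    exact e
  have := (union_support_eq_univ hnabla hξ hne).ge (Set.mem_univ x)
  rcases this with ⟨u, hu⟩ | h
  · exact hu (h0 x hx u)
  · exact h1 h

/-- If `∇ξ` vanishes on an open set, the prolongation equation gives `ρ(X, Y) ξ(Z) = 0` there, hence
`ξ = 0` since `ρ ≠ 0`. -/
theorem dense_derivSupport [T2Space M] [ConnectedSpace M] (hnabla : IsRSTS nabla)
    (hricci : ∀ x : M, ∃ u w : TangentSpace (𝓡 2) x, ricci nabla x u w ≠ 0)
    (hξ : ξ ∈ killingKernel nabla) (hne : ξ ≠ 0) : Dense (derivSupport nabla ξ) := by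
  refine dense_iff_inter_open.2 fun V hV ⟨x, hx⟩ => ?_
  by_contra hemp
  have h0 : ∀ y ∈ V, ∀ u v, covDerivForm nabla ξ y u v = 0 := fun y hy u v => by
    by_contra hu
    exact hemp ⟨y, hy, u, v, hu⟩
  have h1 : x ∉ formSupport ξ := by
    rintro ⟨z, hz⟩
    obtain ⟨u, w, huw⟩ := hricci x
    have hVD : IsOpen (V ∩ chartDomain x) := hV.inter (isOpen_chartDomain x)
    have hxV : x ∈ V ∩ chartDomain x := ⟨hx, mem_chartDomain x⟩
    have s (u : TangentSpace (𝓡 2) x) : SmoothField (V ∩ chartDomain x)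
      (extend (EuclideanSpace ℝ (Fin 2)) u) := (smoothField_extend u).mono Set.inter_subset_right
    have e := secondCovDeriv_eq hnabla hξ hVD hxV (s u) (s w) (s z)
    rw [secondCovDeriv, h0 x hx, h0 x hx, dirDeriv_congr (g := fun _ => 0) hVD hxV
      fun y hy => h0 y hy.1 _ _, dirDeriv_const, extend_apply_self, extend_apply_self,
      extend_apply_self, sub_zero, sub_zero, eq_comm, neg_eq_zero] at e
    exact (mul_ne_zero huw hz) e
  have := (union_support_eq_univ hnabla hξ hne).ge (Set.mem_univ x)
  rcases this with h | ⟨u, v, hu⟩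
  · exact h1 h
  · exact hu (h0 x hx u v)

end UniqueContinuation

/-! ### Existence of adapted frames -/

section Dense

variable {M : Type*} [TopologicalSpace M] [ChartedSpace (EuclideanSpace ℝ (Fin 2)) M]
  [IsManifold (𝓡 2) ∞ M]

variable {W : Set M} {X Y Z : Π x : M, TangentSpace (𝓡 2) x} {ψ : M → ℝ} {x : M}
  {nabla : Connection M} {ξ : OneForm M}

/-- With `X, Y` local fields, `t = ξ(X)`, `r = ρ(X, Y)` and `β = ∇ξ(X, Y)`, the requirement `∇ξ =
(ψ/4) ρ` gives `ψ = 4β/r`; solving `ρ(v, ·) = 4ξ` gives `v = (4 ξ(Y) X - 4 t Y)/r`; and `e = (ψ/t)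
X` has `ξ(e) = ψ`. -/
theorem exists_isKillingFrame [T2Space M] (hnabla : IsRSTS nabla) (hξ : ξ ∈ killingKernel nabla)
    (hricci : ∃ u w : TangentSpace (𝓡 2) x, ricci nabla x u w ≠ 0)
    (hx : x ∈ formSupport ξ) (hx' : x ∈ derivSupport nabla ξ) :
    ∃ W v e ψ, x ∈ W ∧ IsKillingFrame nabla ξ W v e ψ := by
  obtain ⟨u, hu⟩ := hx
  obtain ⟨a, b, hab⟩ := hx'
  -- A nonzero skew form on a plane is nondegenerate: if `ρ(u, ·) = 0`, the cyclic identity makes `u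
  -- = 0`, against `ξ(u) ≠ 0`.
  obtain ⟨w, hw⟩ : ∃ w, ricci nabla x u w ≠ 0 := by
    obtain ⟨u', w', h⟩ := hricci
    by_contra! h0
    have c := hnabla.ricci_cyclic u' w' u
    rw [h0, hnabla.ricci_skew x u' u, h0, neg_zero, zero_smul, zero_smul, add_zero] at c
    rw [(smul_eq_zero.1 c).resolve_left h] at hu
    exact hu (map_zero _)
  -- A skew form that vanishes on the pair `u, w`, which spans the plane as `ρ(u, w) ≠ 0`, is zero.
  have hβ : covDerivForm nabla ξ x u w ≠ 0 := by
    intro h0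
    have h1 (z : TangentSpace (𝓡 2) x) : covDerivForm nabla ξ x u z = 0 := by
      have c := congrArg (covDerivForm nabla ξ x u) (hnabla.ricci_cyclic u w z)
      rw [covDerivForm_smul_right hξ, covDerivForm_add_right hξ, covDerivForm_smul_right hξ,
        covDerivForm_smul_right hξ, h0, covDerivForm_self hξ, mul_zero, mul_zero, add_zero] at c
      exact (mul_eq_zero.1 c).resolve_left hw
    have h2 (z : TangentSpace (𝓡 2) x) : covDerivForm nabla ξ x w z = 0 := by
      have c := congrArg (covDerivForm nabla ξ x w) (hnabla.ricci_cyclic u w z)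
      rw [covDerivForm_smul_right hξ, covDerivForm_add_right hξ, covDerivForm_smul_right hξ,
        covDerivForm_smul_right hξ, covDerivForm_skew hξ w u, h0, covDerivForm_self hξ, neg_zero,
        mul_zero, mul_zero, add_zero] at c
      exact (mul_eq_zero.1 c).resolve_left hw
    have c := congrArg (fun z => covDerivForm nabla ξ x z b) (hnabla.ricci_cyclic u w a)
    simp only [covDerivForm_add_left, covDerivForm_smul_left, h1, h2, mul_zero, add_zero] at c
    exact hab ((mul_eq_zero.1 c).resolve_left hw)
  set X : Π y : M, TangentSpace (𝓡 2) y := extend (EuclideanSpace ℝ (Fin 2)) u with hXdef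
  set Y : Π y : M, TangentSpace (𝓡 2) y := extend (EuclideanSpace ℝ (Fin 2)) w with hYdef
  have hXx : X x = u := extend_apply_self _ u
  have hYx : Y x = w := extend_apply_self _ w
  have hD := isOpen_chartDomain x
  have sX : SmoothField (chartDomain x) X := smoothField_extend u
  have sY : SmoothField (chartDomain x) Y := smoothField_extend w
  set t : M → ℝ := pairing ξ X
  set r : M → ℝ := fun y => ricci nabla y (X y) (Y y)
  set β : M → ℝ := fun y => covDerivForm nabla ξ y (X y) (Y y)
  have st : SmoothFun (chartDomain x) t := smoothFun_pairing ξ sX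
  have st' : SmoothFun (chartDomain x) (pairing ξ Y) := smoothFun_pairing ξ sY
  have sr : SmoothFun (chartDomain x) r := hnabla.smoothFun_ricci hD sX sY
  have sβ : SmoothFun (chartDomain x) β := smoothFun_covDerivForm hnabla.smooth ξ hD sX sY
  have sp : SmoothFun (chartDomain x) (fun y => t y * r y * β y) := (st.mul sr).mul sβ
  set W : Set M := chartDomain x ∩ (fun y => t y * r y * β y) ⁻¹' {0}ᶜ
  have hW : IsOpen W := sp.continuousOn.isOpen_inter_preimage hD isOpen_compl_singleton
  have hWD : W ⊆ chartDomain x := Set.inter_subset_left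
  have ht : ∀ y ∈ W, t y ≠ 0 := fun y hy => left_ne_zero_of_mul (left_ne_zero_of_mul hy.2)
  have hr : ∀ y ∈ W, r y ≠ 0 := fun y hy => right_ne_zero_of_mul (left_ne_zero_of_mul hy.2)
  have hβ' : ∀ y ∈ W, β y ≠ 0 := fun y hy => right_ne_zero_of_mul hy.2
  have four : SmoothFun W (fun _ => 4) := contMDiffOn_const
  have sψ : SmoothFun W (fun y => 4 * β y / r y) :=
    (four.mul (sβ.mono hWD)).div₀ (sr.mono hWD) hr
  have s1 : SmoothFun W (fun y => 4 * pairing ξ Y y / r y) :=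
    (four.mul (st'.mono hWD)).div₀ (sr.mono hWD) hr
  have s2 : SmoothFun W (fun y => 4 * t y / r y) :=
    (four.mul (st.mono hWD)).div₀ (sr.mono hWD) hr
  have s3 : SmoothFun W (fun y => 4 * β y / r y / t y) := sψ.div₀ (st.mono hWD) ht
  have hv (y : M) : ((fun y => 4 * pairing ξ Y y / r y) • X + -((fun y => 4 * t y / r y) • Y)) y
    = (4 * pairing ξ Y y / r y) • X y + (-(4 * t y / r y)) • Y y := by
    rw [neg_smul]; rfl
  refine ⟨W, (fun y => 4 * pairing ξ Y y / r y) • X + -((fun y => 4 * t y / r y) • Y),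
    (fun y => 4 * β y / r y / t y) • X, fun y => 4 * β y / r y, ⟨mem_chartDomain x, ?_⟩, ?_⟩
  · simp only [Set.mem_preimage, t, r, β, pairing, hXx, hYx]
    exact mul_ne_zero (mul_ne_zero hu hw) hβ
  · refine
      { isOpen := hW
        smooth_v := (SmoothField.smul s1 (sX.mono hWD)).add (SmoothField.smul s2 (sY.mono hWD)).neg
        smooth_e := SmoothField.smul s3 (sX.mono hWD)
        smooth_psi := sψ
        psi_ne_zero := fun y hy => div_ne_zero (mul_ne_zero four_ne_zero (hβ' y hy)) (hr y hy)
        eval_v := fun y hy => ?_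
        eval_e := fun y hy => ?_
        ricci_v_e := fun y hy => ?_
        deriv_v_e := fun y hy => ?_ }
    · rw [hv, map_add, map_smul, map_smul]
      change (4 * pairing ξ Y y / r y) * t y + (-(4 * t y / r y)) * pairing ξ Y y = 0
      ring
    · rw [Pi.smul_apply', map_smul]
      exact div_mul_cancel₀ _ (ht y hy)
    · rw [hv, Pi.smul_apply', hnabla.ricci_smul_right, hnabla.ricci_add_left,
        hnabla.ricci_smul_left, hnabla.ricci_smul_left, hnabla.ricci_self,
        hnabla.ricci_skew y (Y y)]
      change 4 * β y / r y / t y * (_ + -(4 * t y / r y) * -r y) = _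
      have := ht y hy
      have := hr y hy
      field_simp
      ring
    · rw [hv, Pi.smul_apply', covDerivForm_smul_right hξ, covDerivForm_add_left,
        covDerivForm_smul_left, covDerivForm_smul_left, covDerivForm_self hξ,
        covDerivForm_skew hξ (Y y)]
      change 4 * β y / r y / t y * (_ + -(4 * t y / r y) * -β y) = _
      have := ht y hy
      have := hr y hy
      field_simp
      ring

end Dense

end SurfaceConnection

end

/-! ### The local normal form on a dense open set -/

theorem theorem17p2 {M : Type*} [TopologicalSpace M] [T2Space M] [SecondCountableTopology M]
    [ConnectedSpace M] [ChartedSpace (EuclideanSpace ℝ (Fin 2)) M] [IsManifold (𝓡 2) ∞ M]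
    (nabla : SurfaceConnection.Connection M)
    (hnabla : SurfaceConnection.IsRSTS nabla)
    (hricci : ∀ x : M, ∃ u w : TangentSpace (𝓡 2) x, SurfaceConnection.ricci nabla x u w ≠ 0)
    (hkernel : Module.finrank ℝ (SurfaceConnection.killingKernel nabla) = 1) :
    ∃ U : Set M, IsOpen U ∧ Dense U ∧ ∀ x ∈ U, ∃ W : Set M, IsOpen W ∧ x ∈ W ∧
      ∃ (v w : Π y : M, TangentSpace (𝓡 2) y) (ψ χ : M → ℝ),
        SurfaceConnection.IsQuadrupleOn W v w ψ χ ∧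
        SurfaceConnection.IsGivenByOn nabla W v w ψ χ := by
  have : Nontrivial (SurfaceConnection.killingKernel nabla) :=
    Module.nontrivial_of_finrank_pos (R := ℝ) (by rw [hkernel]; exact one_pos)
  obtain ⟨ξ, hξ0⟩ := exists_ne (0 : SurfaceConnection.killingKernel nabla)
  have hξ := ξ.2
  have hne : (ξ : SurfaceConnection.OneForm M) ≠ 0 := fun h => hξ0 (Subtype.ext h)
  refine ⟨SurfaceConnection.formSupport ξ.1 ∩ SurfaceConnection.derivSupport nabla ξ.1,
    (SurfaceConnection.isOpen_formSupport _).inter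
      (SurfaceConnection.isOpen_derivSupport hnabla.smooth _),
    (SurfaceConnection.dense_formSupport hnabla hξ hne).inter_of_isOpen_left
      (SurfaceConnection.dense_derivSupport hnabla hricci hξ hne)
      (SurfaceConnection.isOpen_formSupport _), fun x hx => ?_⟩
  obtain ⟨W, v, e, ψ, hxW, h⟩ :=
    SurfaceConnection.exists_isKillingFrame hnabla hξ (hricci x) hx.1 hx.2
  obtain ⟨w, χ, h1, h2⟩ := h.exists_quadruple hnabla hξ
  exact ⟨W, h.isOpen, hxW, v, w, ψ, χ, h1, h2⟩
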